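/- Let $X$ be a Banach space over $\mathbb K\in\{\mathbb R,\mathbb C\}$ and let $\{U(t,\tau)\}_{t\ge\tau}$, $t,\tau\in\mathbb R$, be a strongly continuous, exponentially bounded evolution family on $X$: the $U(t,\tau)$ are bounded linear operators on $X$ such that (1) for each $x\in X$ the map $(t,\tau)\mapsto U(t,\tau)x$ is continuous on $\{(t,\tau)\in\mathbb R^2: t\ge\tau\}$; (2) for some $\omega\in\mathbb R$, $\sup_{t\ge\tau}\|e^{-\omega(t-\tau)}U(t,\tau)\|<\infty$; (3) $U(t,t)=I$ and $U(t,\tau)=U(t,s)U(s,\tau)$ for all $t\ge s\ge\tau$. Let $\mathcal E=L_p(\mathbb R;X)$ for some $p\in[1,\infty)$ (respectively $\mathcal E=C_0(\mathbb R;X)$, the space of continuous functions vanishing at $\pm\infty$ with the supremum norm), and let $\mathbf G$ be the generator of the associated evolution semigroup $\{T^t\}_{t\ge0}$ on $\mathcal E$, $(T^tu)(\tau)=U(\tau,\tau-t)u(\tau-t)$. That is, $\operatorname{dom}\mathbf G$ consists of those $u\in\mathcal E$ for which $\lim_{h\to0^+}h^{-1}(T^hu-u)$ exists in $\mathcal E$,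 and $\mathbf Gu$ is this limit. Let $D$ be the bounded operator on $\ell_p(\mathbb Z;X)$ with the same $p$ (respectively on $c_0(\mathbb Z;X)$, the space of sequences vanishing at $\pm\infty$ with the supremum norm) given by $$D:(x_n)_{n\in\mathbb Z}\mapsto (x_n-U(n,n-1)x_{n-1})_{n\in\mathbb Z}.$$ Then, in each of these cases: 1. $\operatorname{Im}\mathbf G$ is closed if and only if $\operatorname{Im}D$ is closed; 2. $\dim\ker\mathbf G=\dim\ker D$ and $\operatorname{codim}\operatorname{Im}\mathbf G=\operatorname{codim}\operatorname{Im}D$, where the dimensions are algebraic dimensions (possibly infinite cardinals) and $\operatorname{codim}$ is the dimension of the algebraic quotient space; 3. $\mathbf G$ is Fredholm if and only if $D$ is Fredholm, and in this case $\operatorname{ind}\mathbf G=\operatorname{ind}D$. Here a closed linear operator $A$ is called Fredholm if $\operatorname{Im}A$ is closed and $\dim\ker A$ and $\operatorname{codim}\operatorname{Im}A$ are finite, and then $\operatorname{ind}A=\dim\ker A-\operatorname{codim}\operatorname{Im}A$. -/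

import Mathlib

open MeasureTheory Filter Topology
open scoped NNReal ENNReal ZeroAtInfty

/-- A strongly continuous, exponentially bounded evolution family `{U(t, τ)}_{t ≥ τ}` on `X`,
indexed by the real line. The values `U t τ` with `t < τ` carry no information. -/
structure EvolutionFamily (𝕜 : Type*) (X : Type*) [RCLike 𝕜] [NormedAddCommGroup X]
    [NormedSpace 𝕜 X] where
  /-- The operators `U(t, τ)`. -/
  U : ℝ → ℝ → X →L[𝕜] X
  continuousOn' : ∀ x : X, ContinuousOn (fun q : ℝ × ℝ => U q.1 q.2 x) {q | q.2 ≤ q.1}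
  exp_bounded' : ∃ ω M : ℝ, ∀ t τ : ℝ, τ ≤ t → ‖U t τ‖ ≤ M * Real.exp (ω * (t - τ))
  self' : ∀ t : ℝ, U t t = ContinuousLinearMap.id 𝕜 X
  comp' : ∀ t s τ : ℝ, τ ≤ s → s ≤ t → U t τ = (U t s).comp (U s τ)

namespace EvolutionFamily

variable {𝕜 : Type*} {X : Type*} [RCLike 𝕜] [NormedAddCommGroup X] [NormedSpace 𝕜 X]

theorem exists_bound (V : EvolutionFamily 𝕜 X) (t : ℝ≥0) :
    ∃ C : ℝ≥0, ∀ τ : ℝ, ‖V.U τ (τ - t)‖ ≤ C := by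
  obtain ⟨ω, M, h⟩ := V.exp_bounded'
  refine ⟨(M * Real.exp (ω * t)).toNNReal, fun τ => ?_⟩
  refine le_trans ?_ (Real.le_coe_toNNReal _)
  have := h τ (τ - t) (by have := t.2; simp)
  rwa [sub_sub_cancel] at this

/-- The map `(τ, x) ↦ U(τ, τ - t) x` is jointly continuous. -/
theorem continuous_step (V : EvolutionFamily 𝕜 X) (t : ℝ≥0) :
    Continuous fun q : ℝ × X => V.U q.1 (q.1 - t) q.2 := by
  obtain ⟨C, hC⟩ := V.exists_bound t
  refine continuous_prod_of_continuous_lipschitzWith' _ C (fun τ => ?_) (fun x => ?_)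
  · refine (V.U τ (τ - t)).lipschitz.weaken ?_
    exact_mod_cast hC τ
  · refine (V.continuousOn' x).comp_continuous (f := fun τ : ℝ => (τ, τ - (t : ℝ)))
      (by fun_prop) (fun τ => ?_)
    simp

theorem memLp_step (V : EvolutionFamily 𝕜 X) (t : ℝ≥0) {p : ℝ≥0∞} {u : ℝ → X}
    (hu : MemLp u p volume) :
    MemLp (fun τ : ℝ => V.U τ (τ - t) (u (τ - t))) p volume := by
  obtain ⟨C, hC⟩ := V.exists_bound t
  have hs : MemLp (fun τ : ℝ => u (τ - t)) p volume :=
    hu.comp_measurePreserving (measurePreserving_sub_right volume (t : ℝ))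
  refine hs.of_le_mul (c := C) ?_ (Eventually.of_forall fun τ => ?_)
  · exact (V.continuous_step t).comp_aestronglyMeasurable
      (aestronglyMeasurable_id.prodMk hs.aestronglyMeasurable)
  · exact (V.U τ (τ - t)).le_of_opNorm_le (hC τ) _

theorem ae_comp_sub {Y : Type*} {u v : ℝ → Y} (t : ℝ) (h : u =ᵐ[volume] v) :
    ∀ᵐ τ : ℝ, u (τ - t) = v (τ - t) :=
  (measurePreserving_sub_right volume t).quasiMeasurePreserving.ae h

/-- The evolution semigroup on `L_p(ℝ; X)`: `(T^t u)(τ) = U(τ, τ - t) u(τ - t)`. -/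
noncomputable def semigroupLp (V : EvolutionFamily 𝕜 X) (p : ℝ≥0∞) [Fact (1 ≤ p)] (t : ℝ≥0) :
    Lp X p (volume : Measure ℝ) →L[𝕜] Lp X p (volume : Measure ℝ) :=
  LinearMap.mkContinuousOfExistsBound
    { toFun := fun u => (V.memLp_step t (Lp.memLp u)).toLp
        (fun τ : ℝ => V.U τ (τ - t) (u (τ - t)))
      map_add' := fun u v => by
        rw [← MemLp.toLp_add]
        refine MemLp.toLp_congr _ _ ?_
        filter_upwards [ae_comp_sub (t : ℝ) (Lp.coeFn_add u v)] with τ hτ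
        rw [hτ, Pi.add_apply, map_add, Pi.add_apply]
      map_smul' := fun c u => by
        rw [RingHom.id_apply, ← MemLp.toLp_const_smul]
        refine MemLp.toLp_congr _ _ ?_
        filter_upwards [ae_comp_sub (t : ℝ) (Lp.coeFn_smul c u)] with τ hτ
        rw [hτ, Pi.smul_apply, map_smul, Pi.smul_apply] }
    (by
      obtain ⟨C, hC⟩ := V.exists_bound t
      refine ⟨C, fun u => ?_⟩
      have hmp := measurePreserving_sub_right (volume : Measure ℝ) (t : ℝ)
      rw [← Lp.norm_compMeasurePreserving u hmp]
      refine Lp.norm_le_mul_norm_of_ae_le_mul ?_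
      filter_upwards [MemLp.coeFn_toLp (V.memLp_step t (Lp.memLp u)),
        Lp.coeFn_compMeasurePreserving u hmp] with τ h1 h2
      simp only [LinearMap.coe_mk, AddHom.coe_mk]
      rw [h1, h2]
      exact (V.U τ (τ - t)).le_of_opNorm_le (hC τ) _)

theorem semigroupLp_apply (V : EvolutionFamily 𝕜 X) (p : ℝ≥0∞) [Fact (1 ≤ p)] (t : ℝ≥0)
    (u : Lp X p (volume : Measure ℝ)) :
    V.semigroupLp p t u =ᵐ[volume] fun τ : ℝ => V.U τ (τ - t) (u (τ - t)) :=
  MemLp.coeFn_toLp (V.memLp_step t (Lp.memLp u))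

/-- The evolution semigroup on `C₀(ℝ; X)`: `(T^t u)(τ) = U(τ, τ - t) u(τ - t)`. -/
noncomputable def semigroupC0 (V : EvolutionFamily 𝕜 X) (t : ℝ≥0) :
    C₀(ℝ, X) →L[𝕜] C₀(ℝ, X) :=
  LinearMap.mkContinuousOfExistsBound
    { toFun := fun u =>
        { toFun := fun τ : ℝ => V.U τ (τ - t) (u (τ - t))
          continuous_toFun := (V.continuous_step t).comp
            (f := fun τ : ℝ => (τ, u (τ - (t : ℝ))))
            (continuous_id.prodMk ((map_continuous u).comp (by fun_prop)))
          zero_at_infty' := by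
            obtain ⟨C, hC⟩ := V.exists_bound t
            have h1 : Tendsto (fun τ : ℝ => τ - (t : ℝ)) (cocompact ℝ) (cocompact ℝ) :=
              (Homeomorph.subRight (t : ℝ)).isClosedEmbedding.tendsto_cocompact
            have h2 := ((zero_at_infty u).comp h1).norm.const_mul (C : ℝ)
            rw [norm_zero, mul_zero] at h2
            exact squeeze_zero_norm (fun τ => (V.U τ (τ - t)).le_of_opNorm_le (hC τ) _) h2 }
      map_add' := fun u v => by ext τ; simp
      map_smul' := fun c u => by ext τ; simp }
    (by
      obtain ⟨C, hC⟩ := V.exists_bound t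
      refine ⟨C, fun u => ?_⟩
      rw [← ZeroAtInftyContinuousMap.norm_toBCF_eq_norm]
      refine (BoundedContinuousFunction.norm_le (by positivity)).2 fun τ => ?_
      refine ((V.U τ (τ - t)).le_of_opNorm_le (hC τ) _).trans ?_
      rw [← ZeroAtInftyContinuousMap.norm_toBCF_eq_norm (f := u)]
      gcongr
      exact u.toBCF.norm_coe_le_norm (τ - t))

@[simp]
theorem semigroupC0_apply (V : EvolutionFamily 𝕜 X) (t : ℝ≥0) (u : C₀(ℝ, X)) (τ : ℝ) :
    V.semigroupC0 t u τ = V.U τ (τ - t) (u (τ - t)) :=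
  rfl

end EvolutionFamily

section Generator

variable {𝕜 : Type*} {E : Type*} [RCLike 𝕜] [NormedAddCommGroup E] [NormedSpace 𝕜 E]

/-- The (infinitesimal) generator of a one-parameter family `T : ℝ≥0 → 𝓛(E)`: its domain consists
of the `u` for which `lim_{h → 0+} h⁻¹ (T^h u - u)` exists in the norm of `E`, and its value at such
a `u` is that limit. -/
noncomputable def semigroupGenerator (T : ℝ≥0 → E →L[𝕜] E) : E →ₗ.[𝕜] E where
  domain :=
    { carrier := {u | ∃ f : E,
        Tendsto (fun h : ℝ≥0 => ((h : ℝ) : 𝕜)⁻¹ • (T h u - u)) (𝓝[>] 0) (𝓝 f)}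
      zero_mem' := ⟨0, by simp⟩
      add_mem' := by
        rintro u v ⟨f, hf⟩ ⟨g, hg⟩
        refine ⟨f + g, (hf.add hg).congr fun h => ?_⟩
        rw [map_add, ← smul_add, add_sub_add_comm]
      smul_mem' := by
        rintro c u ⟨f, hf⟩
        refine ⟨c • f, (hf.const_smul c).congr fun h => ?_⟩
        rw [map_smul, smul_comm c, smul_sub] }
  toFun :=
    { toFun := fun u => u.2.choose
      map_add' := fun u v => by
        refine tendsto_nhds_unique (u + v).2.choose_spec
          ((u.2.choose_spec.add v.2.choose_spec).congr fun h => ?_)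
        rw [Submodule.coe_add, map_add, ← smul_add, add_sub_add_comm]
      map_smul' := fun c u => by
        refine tendsto_nhds_unique (c • u).2.choose_spec
          ((u.2.choose_spec.const_smul c).congr fun h => ?_)
        rw [Submodule.coe_smul, map_smul, smul_comm c, smul_sub] }

theorem mem_semigroupGenerator_domain_iff (T : ℝ≥0 → E →L[𝕜] E) (u : E) :
    u ∈ (semigroupGenerator T).domain ↔ ∃ f : E,
      Tendsto (fun h : ℝ≥0 => ((h : ℝ) : 𝕜)⁻¹ • (T h u - u)) (𝓝[>] 0) (𝓝 f) :=
  Iff.rfl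

theorem tendsto_semigroupGenerator (T : ℝ≥0 → E →L[𝕜] E) (u : (semigroupGenerator T).domain) :
    Tendsto (fun h : ℝ≥0 => ((h : ℝ) : 𝕜)⁻¹ • (T h (u : E) - (u : E))) (𝓝[>] 0)
      (𝓝 (semigroupGenerator T u)) :=
  u.2.choose_spec

/-- An unbounded operator is Fredholm if it is closed, its range is closed, and its kernel and
cokernel are finite dimensional. -/
structure IsFredholmPMap (G : E →ₗ.[𝕜] E) : Prop where
  isClosed : G.IsClosed
  isClosed_range : IsClosed (LinearMap.range G.toFun : Set E)
  finite_ker : FiniteDimensional 𝕜 (LinearMap.ker G.toFun)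
  finite_coker : FiniteDimensional 𝕜 (E ⧸ LinearMap.range G.toFun)

end Generator

namespace EvolutionFamily

variable {𝕜 : Type*} {X : Type*} [RCLike 𝕜] [NormedAddCommGroup X] [NormedSpace 𝕜 X]

/-- The generator `𝐆` of the evolution semigroup on `L_p(ℝ; X)`. -/
noncomputable def generatorLp (V : EvolutionFamily 𝕜 X) (p : ℝ≥0∞) [Fact (1 ≤ p)] :
    Lp X p (volume : Measure ℝ) →ₗ.[𝕜] Lp X p (volume : Measure ℝ) :=
  semigroupGenerator (V.semigroupLp p)

/-- The generator `𝐆` of the evolution semigroup on `C₀(ℝ; X)`. -/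
noncomputable def generatorC0 (V : EvolutionFamily 𝕜 X) : C₀(ℝ, X) →ₗ.[𝕜] C₀(ℝ, X) :=
  semigroupGenerator V.semigroupC0

theorem exists_bound_int (V : EvolutionFamily 𝕜 X) :
    ∃ C : ℝ≥0, ∀ n : ℤ, ‖V.U n (n - 1)‖ ≤ C := by
  obtain ⟨C, hC⟩ := V.exists_bound 1
  exact ⟨C, fun n => by simpa using hC n⟩

theorem exists_bound_lp (V : EvolutionFamily 𝕜 X) (p : ℝ≥0∞) [Fact (1 ≤ p)] :
    ∃ C : ℝ, 0 ≤ C ∧ ∀ x : lp (fun _ : ℤ => X) p,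
      ∃ h : Memℓp (fun n : ℤ => V.U n (n - 1) (x (n - 1))) p,
        ‖(⟨_, h⟩ : lp (fun _ : ℤ => X) p)‖ ≤ C * ‖x‖ := by
  obtain ⟨C, hC⟩ := V.exists_bound_int
  refine ⟨C, C.2, fun x => ?_⟩
  have hle : ∀ n : ℤ, ‖V.U n (n - 1) (x (n - 1))‖ ≤ C * ‖x (n - 1)‖ :=
    fun n => (V.U n (n - 1)).le_of_opNorm_le (hC n) _
  have hp1 : 1 ≤ p := Fact.out
  obtain rfl | rfl | hp := p.trichotomy
  · simp at hp1
  · have hle' : ∀ n : ℤ, ‖V.U n (n - 1) (x (n - 1))‖ ≤ C * ‖x‖ := fun n =>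
      (hle n).trans (by gcongr; exact lp.norm_apply_le_norm (by simp) x _)
    refine ⟨memℓp_infty ⟨C * ‖x‖, ?_⟩, lp.norm_le_of_forall_le (by positivity) hle'⟩
    rintro _ ⟨n, rfl⟩
    exact hle' n
  · have hs := ((Equiv.subRight (1 : ℤ)).hasSum_iff.2 (lp.hasSum_norm hp x)).mul_left
      ((C : ℝ) ^ p.toReal)
    have hle' : ∀ n : ℤ, ‖V.U n (n - 1) (x (n - 1))‖ ^ p.toReal ≤
        (C : ℝ) ^ p.toReal * ‖x (n - 1)‖ ^ p.toReal := fun n => by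
      rw [← Real.mul_rpow (by positivity) (by positivity)]
      gcongr
      exact hle n
    have hsum : Summable fun n : ℤ => ‖V.U n (n - 1) (x (n - 1))‖ ^ p.toReal :=
      Summable.of_nonneg_of_le (fun n => by positivity) hle' hs.summable
    refine ⟨memℓp_gen hsum, lp.norm_le_of_tsum_le hp (by positivity) ?_⟩
    rw [Real.mul_rpow (by positivity) (norm_nonneg _)]
    exact hasSum_le hle' hsum.hasSum hs

/-- The difference operator `D : (x_n) ↦ (x_n - U(n, n - 1) x_{n - 1})` on `ℓ_p(ℤ; X)`. -/
noncomputable def differenceLp (V : EvolutionFamily 𝕜 X) (p : ℝ≥0∞) [Fact (1 ≤ p)] :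
    lp (fun _ : ℤ => X) p →L[𝕜] lp (fun _ : ℤ => X) p :=
  LinearMap.mkContinuousOfExistsBound
    { toFun := fun x => ⟨fun n : ℤ => x n - V.U n (n - 1) (x (n - 1)),
        (lp.memℓp x).sub ((V.exists_bound_lp p).choose_spec.2 x).choose⟩
      map_add' := fun x y => by
        ext n
        simp only [lp.coeFn_add, Pi.add_apply, map_add]
        exact add_sub_add_comm _ _ _ _
      map_smul' := fun c x => by
        ext n
        simp only [lp.coeFn_smul, Pi.smul_apply, map_smul, RingHom.id_apply, smul_sub] }
    (by
      obtain ⟨C, hC0, hC⟩ := V.exists_bound_lp p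
      refine ⟨1 + C, fun x => ?_⟩
      obtain ⟨h, hx⟩ := hC x
      refine (norm_sub_le x (⟨_, h⟩ : lp (fun _ : ℤ => X) p)).trans ?_
      linarith)

@[simp]
theorem differenceLp_apply (V : EvolutionFamily 𝕜 X) (p : ℝ≥0∞) [Fact (1 ≤ p)]
    (x : lp (fun _ : ℤ => X) p) (n : ℤ) :
    V.differenceLp p x n = x n - V.U n (n - 1) (x (n - 1)) :=
  rfl

/-- The difference operator `D : (x_n) ↦ (x_n - U(n, n - 1) x_{n - 1})` on `c₀(ℤ; X)`, the space
of sequences vanishing at `±∞` with the supremum norm (`ℤ` is discrete). -/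
noncomputable def differenceC0 (V : EvolutionFamily 𝕜 X) : C₀(ℤ, X) →L[𝕜] C₀(ℤ, X) :=
  LinearMap.mkContinuousOfExistsBound
    { toFun := fun x =>
        { toFun := fun n : ℤ => x n - V.U n (n - 1) (x (n - 1))
          continuous_toFun := continuous_of_discreteTopology
          zero_at_infty' := by
            obtain ⟨C, hC⟩ := V.exists_bound_int
            have h1 : Tendsto (fun n : ℤ => n - 1) (cocompact ℤ) (cocompact ℤ) :=
              (Homeomorph.subRight (1 : ℤ)).isClosedEmbedding.tendsto_cocompact
            have h2 := ((zero_at_infty x).comp h1).norm.const_mul (C : ℝ)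
            rw [norm_zero, mul_zero] at h2
            have h3 : Tendsto (fun n : ℤ => V.U n (n - 1) (x (n - 1))) (cocompact ℤ) (𝓝 0) :=
              squeeze_zero_norm (fun n => (V.U n (n - 1)).le_of_opNorm_le (hC n) _) h2
            simpa using (zero_at_infty x).sub h3 }
      map_add' := fun x y => by ext n; simp; abel
      map_smul' := fun c x => by ext n; simp [smul_sub] }
    (by
      obtain ⟨C, hC⟩ := V.exists_bound_int
      refine ⟨1 + C, fun x => ?_⟩
      rw [← ZeroAtInftyContinuousMap.norm_toBCF_eq_norm]
      refine (BoundedContinuousFunction.norm_le (by positivity)).2 fun n => ?_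
      have hx : ∀ m : ℤ, ‖x m‖ ≤ ‖x‖ := fun m => by
        rw [← ZeroAtInftyContinuousMap.norm_toBCF_eq_norm (f := x)]
        exact x.toBCF.norm_coe_le_norm m
      have h1 : ‖V.U n (n - 1) (x (n - 1))‖ ≤ C * ‖x‖ :=
        ((V.U n (n - 1)).le_of_opNorm_le (hC n) _).trans (by gcongr; exact hx _)
      refine (norm_sub_le (x n) (V.U n (n - 1) (x (n - 1)))).trans ?_
      linarith [hx n])

@[simp]
theorem differenceC0_apply (V : EvolutionFamily 𝕜 X) (x : C₀(ℤ, X)) (n : ℤ) :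
    V.differenceC0 x n = x n - V.U n (n - 1) (x (n - 1)) :=
  rfl

end EvolutionFamily

/-!
The operators `𝐆` and `D` have the same Fredholm data because each of them is linked to the other by
a bounded operator. Write `N u = (∫_{n - 1}^n U(n, s) u(s) ds)_n` for the sampling operator
(`CellModel.sampling`) and `Q` for the operator that spreads `x_n` along `U(t, n) x_n` over the
cell `[n, n + 1)` with a weight of integral one (`CellModel.spreading`). Then `N Q = 1 - D`
(`CellModel.sampling_spreading`), and the crucial fact is that `f ∈ Im 𝐆` if and only if
`N f ∈ Im D` (`CellModel.mem_range_generator_iff`). Hence `y ∈ Im D` if and only if `Q y ∈ Im 𝐆`, so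
each range is the preimage of the other under a bounded operator, one is closed exactly when the
other is, and `N` induces an isomorphism of the cokernels (`fredholm_transfer`). On the kernels,
`N` is itself an isomorphism (`CellModel.nonempty_ker_equiv`).

To work with `𝐆`, let `(A_h f)(τ) = ∫_{τ - h}^τ U(τ, s) f(s) ds`. The identity
`A_t T^h + A_h = A_t + T^t A_h` and the convergence `h⁻¹ A_h → 1` give: `𝐆 u = f` if and only if
`T^t u - u = A_t f` for all `t ≥ 0` (`mem_graph_semigroupGenerator_iff`). In particular `𝐆` is
closed. If `𝐆 u = f`, then suitable averages over `[n - 1, n]` replace the values `u(n)` and give a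
sequence `x` with `D x = -N f` (`EvolutionFamily.meanValue_sub_prop`). Conversely, if `D x = -N f`,
then starting at each integer `n` from `x_n` and solving `𝐆 u = f` on `[n, n + 1)` produces pieces
that fit together to a mild solution on the line (`EvolutionFamily.orbit_mild`).

The argument is carried out once, in a pair of spaces subject to a few domination properties
(`CellModel`), which both `(L_p, ℓ_p)` and `(C₀, c₀)` satisfy; in `L_p` they rest on Jensen's
inequality over intervals and Tonelli's theorem.
-/

/-! ### The propagator -/

theorem MeasureTheory.LocallyIntegrable.intervalIntegrable_real {Y : Type*} [NormedAddCommGroup Y]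
    {f : ℝ → Y} (hf : LocallyIntegrable f) {a b : ℝ} : IntervalIntegrable f volume a b :=
  (hf.integrableOn_isCompact isCompact_uIcc).intervalIntegrable

namespace EvolutionFamily

variable {𝕜 : Type*} {X : Type*} [RCLike 𝕜] [NormedAddCommGroup X] [NormedSpace 𝕜 X]

/-- The evolution family extended to all pairs `(t, s)` by the identity for `t < s`. This extension
is continuous on the whole plane, so integrands such as `s ↦ U(t, s) f(s)` may be formed without
restricting `s`. -/
noncomputable def prop (V : EvolutionFamily 𝕜 X) (t s : ℝ) : X →L[𝕜] X := V.U (max t s) s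

theorem prop_of_le (V : EvolutionFamily 𝕜 X) {s t : ℝ} (h : s ≤ t) : V.prop t s = V.U t s := by
  rw [prop, max_eq_left h]

@[simp]
theorem prop_self (V : EvolutionFamily 𝕜 X) (t : ℝ) (x : X) : V.prop t t x = x := by
  simp [prop, V.self']

theorem prop_prop (V : EvolutionFamily 𝕜 X) {t r s : ℝ} (hs : s ≤ r) (hr : r ≤ t) (x : X) :
    V.prop t r (V.prop r s x) = V.prop t s x := by
  rw [prop_of_le V hs, prop_of_le V hr, prop_of_le V (hs.trans hr), V.comp' t r s hs hr]
  rfl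

/-- A bound for the propagator over time spans of length at most `a`. -/
theorem exists_prop_bound (V : EvolutionFamily 𝕜 X) (a : ℝ) :
    ∃ C : ℝ, 0 ≤ C ∧ ∀ t s : ℝ, t - s ≤ a → ‖V.prop t s‖ ≤ C := by
  obtain ⟨ω, M, h⟩ := V.exp_bounded'
  refine ⟨|M| * Real.exp (|ω| * max a 0), by positivity, fun t s hts => ?_⟩
  refine (h (max t s) s (le_max_right _ _)).trans ?_
  have h1 : max t s - s ≤ max a 0 := by
    rcases le_total t s with h | h
    · simp [h]
    · rw [max_eq_left h]; exact hts.trans (le_max_left _ _)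
  have h0 : 0 ≤ max t s - s := by simp
  gcongr
  · exact le_abs_self M
  · exact le_abs_self ω

theorem continuous_prop_apply (V : EvolutionFamily 𝕜 X) (x : X) :
    Continuous fun q : ℝ × ℝ => V.prop q.1 q.2 x :=
  (V.continuousOn' x).comp_continuous (f := fun q : ℝ × ℝ => (max q.1 q.2, q.2)) (by fun_prop)
    (fun q => by simp)

/-- The propagator is jointly continuous in both times and the vector. -/
theorem continuous_prop (V : EvolutionFamily 𝕜 X) :
    Continuous fun q : (ℝ × ℝ) × X => V.prop q.1.1 q.1.2 q.2 := by
  obtain ⟨ω, M, h⟩ := V.exp_bounded'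
  -- rescaling by the exponential makes the operators uniformly bounded
  have key : Continuous fun q : (ℝ × ℝ) × X =>
      ((Real.exp (-(ω * (max q.1.1 q.1.2 - q.1.2))) : ℝ) : 𝕜) • V.prop q.1.1 q.1.2 q.2 := by
    refine continuous_prod_of_continuous_lipschitzWith' _ M.toNNReal (fun q => ?_) (fun x => ?_)
    · refine LipschitzWith.of_dist_le_mul fun x y => ?_
      rw [dist_eq_norm, dist_eq_norm, ← smul_sub, ← map_sub, norm_smul, RCLike.norm_ofReal,
        abs_of_pos (Real.exp_pos _)]
      have h1 := (V.prop q.1 q.2).le_of_opNorm_le (h (max q.1 q.2) q.2 (le_max_right _ _)) (x - y)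
      calc _ ≤ Real.exp (-(ω * (max q.1 q.2 - q.2))) *
              (M * Real.exp (ω * (max q.1 q.2 - q.2)) * ‖x - y‖) := by gcongr
        _ = (Real.exp (-(ω * (max q.1 q.2 - q.2))) * Real.exp (ω * (max q.1 q.2 - q.2))) * M *
              ‖x - y‖ := by ring
        _ = M * ‖x - y‖ := by rw [← Real.exp_add]; simp
        _ ≤ M.toNNReal * ‖x - y‖ := by gcongr; exact Real.le_coe_toNNReal M
    · exact (RCLike.continuous_ofReal.comp (by fun_prop)).smul (V.continuous_prop_apply x)
  have h2 : Continuous fun q : (ℝ × ℝ) × X =>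
      ((Real.exp (ω * (max q.1.1 q.1.2 - q.1.2)) : ℝ) : 𝕜) :=
    RCLike.continuous_ofReal.comp (by fun_prop)
  refine (h2.smul key).congr fun q => ?_
  rw [Pi.smul_apply']
  rw [smul_smul, ← RCLike.ofReal_mul, ← Real.exp_add]
  simp

theorem continuous_prop_comp (V : EvolutionFamily 𝕜 X) {Y : Type*} [TopologicalSpace Y]
    {t s : Y → ℝ} {g : Y → X} (ht : Continuous t) (hs : Continuous s) (hg : Continuous g) :
    Continuous fun y => V.prop (t y) (s y) (g y) :=
  V.continuous_prop.comp ((ht.prodMk hs).prodMk hg)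

theorem aestronglyMeasurable_prop (V : EvolutionFamily 𝕜 X) {μ : Measure ℝ} {f : ℝ → X}
    (hf : AEStronglyMeasurable f μ) (t : ℝ) :
    AEStronglyMeasurable (fun s => V.prop t s (f s)) μ :=
  (V.continuous_prop_comp (t := fun _ : ℝ × X => t) continuous_const continuous_fst
    continuous_snd).comp_aestronglyMeasurable (aestronglyMeasurable_id.prodMk hf)

theorem norm_prop_le (V : EvolutionFamily 𝕜 X) {C a : ℝ}
    (hC : ∀ t s : ℝ, t - s ≤ a → ‖V.prop t s‖ ≤ C) {t s : ℝ} (h : t - s ≤ a) (x : X) :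
    ‖V.prop t s x‖ ≤ C * ‖x‖ :=
  (V.prop t s).le_of_opNorm_le (hC t s h) x

/-! ### Integrals along the propagator -/

theorem intervalIntegrable_prop (V : EvolutionFamily 𝕜 X) {f : ℝ → X}
    (hf : LocallyIntegrable f) (t a b : ℝ) :
    IntervalIntegrable (fun s => V.prop t s (f s)) volume a b := by
  obtain ⟨C, hC0, hC⟩ := V.exists_prop_bound (t - min a b)
  have hi : IntervalIntegrable f volume a b := hf.intervalIntegrable_real
  refine (hi.norm.const_mul C).mono_fun
    (V.aestronglyMeasurable_prop hi.aestronglyMeasurable_restrict_uIoc t) ?_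
  refine (ae_restrict_iff' measurableSet_uIoc).2 (Eventually.of_forall fun s hs => ?_)
  refine (V.norm_prop_le hC ?_ _).trans (le_abs_self _)
  have := hs.1
  linarith

section Integral

variable [NormedSpace ℝ X]

theorem norm_integral_prop_le (V : EvolutionFamily 𝕜 X) {C r : ℝ} {f : ℝ → X}
    (hC : ∀ t s : ℝ, t - s ≤ r → ‖V.prop t s‖ ≤ C)
    (hf : LocallyIntegrable f) {t a b : ℝ} (hab : a ≤ b) (h : t - a ≤ r) :
    ‖∫ s in a..b, V.prop t s (f s)‖ ≤ C * ∫ s in a..b, ‖f s‖ := by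
  rw [← intervalIntegral.integral_const_mul]
  refine (intervalIntegral.norm_integral_le_integral_norm hab).trans ?_
  refine intervalIntegral.integral_mono_on hab (V.intervalIntegrable_prop hf t a b).norm
    (hf.intervalIntegrable_real.norm.const_mul C) fun s hs => ?_
  exact V.norm_prop_le hC (by linarith [hs.1]) _

/-- The primitive `∫_a^b U(t, s) f(s) ds` is jointly continuous in `t` and `b`. -/
theorem continuous_integral_prop (V : EvolutionFamily 𝕜 X) {f : ℝ → X}
    (hf : LocallyIntegrable f) (a : ℝ) :
    Continuous fun q : ℝ × ℝ => ∫ s in a..q.2, V.prop q.1 s (f s) := by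
  refine continuous_iff_continuousAt.2 fun ⟨t₀, b₀⟩ => ?_
  set l := min a b₀ - 1
  set r := max a b₀ + 1
  have hlr : l ≤ r := by simp only [l, r]; linarith [min_le_max (a := a) (b := b₀)]
  obtain ⟨C, hC0, hC⟩ := V.exists_prop_bound (t₀ + 1 - l)
  refine intervalIntegral.continuousAt_parametric_primitive_of_dominated
    (F := fun t s => V.prop t s (f s)) (fun s => C * ‖f s‖) l r
    (fun t => V.aestronglyMeasurable_prop hf.aestronglyMeasurable.restrict t) ?_
    (hf.intervalIntegrable_real.norm.const_mul C) (Eventually.of_forall fun s => ?_) ?_ ?_ (by simp)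
  · filter_upwards [eventually_le_nhds (show t₀ < t₀ + 1 by linarith)] with t ht
    refine (ae_restrict_iff' measurableSet_uIoc).2 (Eventually.of_forall fun s hs => ?_)
    rw [Set.uIoc_of_le hlr] at hs
    exact V.norm_prop_le hC (by linarith [hs.1]) _
  · exact (V.continuous_prop_comp continuous_id continuous_const continuous_const).continuousAt
  · constructor
    · simp only [l]; linarith [min_le_left a b₀]
    · simp only [r]; linarith [le_max_left a b₀]
  · constructor
    · simp only [l]; linarith [min_le_right a b₀]
    · simp only [r]; linarith [le_max_right a b₀]

theorem continuous_integral_prop_comp (V : EvolutionFamily 𝕜 X) {f : ℝ → X}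
    (hf : LocallyIntegrable f) {Y : Type*} [TopologicalSpace Y] {t a b : Y → ℝ}
    (ht : Continuous t) (ha : Continuous a) (hb : Continuous b) :
    Continuous fun y => ∫ s in a y..b y, V.prop (t y) s (f s) := by
  have h := fun c : Y → ℝ => fun hc : Continuous c =>
    (V.continuous_integral_prop hf 0).comp (ht.prodMk hc)
  refine ((h b hb).sub (h a ha)).congr fun y => ?_
  exact intervalIntegral.integral_interval_sub_left (V.intervalIntegrable_prop hf _ _ _)
    (V.intervalIntegrable_prop hf _ _ _)

theorem prop_integral [CompleteSpace X] (V : EvolutionFamily 𝕜 X) {f : ℝ → X}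
    (hf : LocallyIntegrable f) {t r a b : ℝ} (ha : a ≤ r) (hb : b ≤ r) (hr : r ≤ t) :
    V.prop t r (∫ s in a..b, V.prop r s (f s)) = ∫ s in a..b, V.prop t s (f s) := by
  rw [← ContinuousLinearMap.intervalIntegral_comp_comm _ (V.intervalIntegrable_prop hf r a b)]
  refine intervalIntegral.integral_congr fun s hs => ?_
  exact V.prop_prop (hs.2.trans (max_le ha hb)) hr _

/-- Integrating `U(t, s)` against the translate `U(s, s - h) f(s - h)` shifts the interval of
integration by `h`. -/
theorem integral_prop_shift (V : EvolutionFamily 𝕜 X) (f : ℝ → X) {h t a b : ℝ} (h0 : 0 ≤ h)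
    (ha : a ≤ t) (hb : b ≤ t) :
    ∫ s in a..b, V.prop t s (V.prop s (s - h) (f (s - h))) =
      ∫ s in (a - h)..(b - h), V.prop t s (f s) := by
  rw [← intervalIntegral.integral_comp_sub_right (fun s => V.prop t s (f s))]
  refine intervalIntegral.integral_congr fun s hs => ?_
  exact V.prop_prop (by linarith) (hs.2.trans (max_le ha hb)) _

theorem integral_prop_congr (V : EvolutionFamily 𝕜 X) {f g : ℝ → X} (h : f =ᵐ[volume] g)
    (t a b : ℝ) : ∫ s in a..b, V.prop t s (f s) = ∫ s in a..b, V.prop t s (g s) :=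
  intervalIntegral.integral_congr_ae (h.mono fun s hs _ => by rw [hs])

theorem integral_prop_add_adjacent (V : EvolutionFamily 𝕜 X) {f : ℝ → X}
    (hf : LocallyIntegrable f) (t a b c : ℝ) :
    (∫ s in a..b, V.prop t s (f s)) + ∫ s in b..c, V.prop t s (f s) =
      ∫ s in a..c, V.prop t s (f s) :=
  intervalIntegral.integral_add_adjacent_intervals (V.intervalIntegrable_prop hf _ _ _)
    (V.intervalIntegrable_prop hf _ _ _)

end Integral

end EvolutionFamily

/-! ### Generators of integrated families -/

section IntegratedSemigroup

variable {𝕜 : Type*} {E : Type*} [RCLike 𝕜] [NormedAddCommGroup E] [NormedSpace 𝕜 E]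

/-- If `A t` behaves like `∫_0^t T^s ds`, then `u ∈ dom G` and `G u = f` mean exactly that
`T^t u - u = A_t f` for all `t`. For the forward implication, the functional equation gives
`A_t (h⁻¹ (T^h u - u)) = (T^t - 1) (h⁻¹ A_h u)`, and one lets `h → 0+`. -/
theorem mem_graph_semigroupGenerator_iff {T A : ℝ≥0 → E →L[𝕜] E}
    (hcomm : ∀ t h u, A t (T h u) + A h u = A t u + T t (A h u))
    (hA : ∀ u, Tendsto (fun h : ℝ≥0 => ((h : ℝ) : 𝕜)⁻¹ • A h u) (𝓝[>] 0) (𝓝 u)) (u f : E) :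
    (u, f) ∈ (semigroupGenerator T).graph ↔ ∀ t, T t u - u = A t f := by
  have hgr : (u, f) ∈ (semigroupGenerator T).graph ↔
      Tendsto (fun h : ℝ≥0 => ((h : ℝ) : 𝕜)⁻¹ • (T h u - u)) (𝓝[>] 0) (𝓝 f) := by
    rw [LinearPMap.mem_graph_iff]
    constructor
    · rintro ⟨y, rfl, rfl⟩
      exact tendsto_semigroupGenerator T y
    · intro h
      exact ⟨⟨u, f, h⟩, rfl, tendsto_nhds_unique (tendsto_semigroupGenerator T ⟨u, f, h⟩) h⟩
  rw [hgr]
  constructor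
  · intro h t
    have h1 := ((A t).continuous.tendsto f).comp h
    have h2 := (((T t).continuous.tendsto u).comp (hA u)).sub (hA u)
    refine tendsto_nhds_unique h2 (h1.congr fun r => ?_)
    simp only [Function.comp_apply, map_smul, ← smul_sub, map_sub]
    congr 1
    rw [sub_eq_sub_iff_add_eq_add, hcomm, add_comm]
  · intro h
    exact (hA f).congr fun t => by rw [h t]

/-- On the fixed space of the semigroup, `A_t` is additive in `t`, hence `A_1` is the identity. -/
theorem integrated_one_of_fixed {T A : ℝ≥0 → E →L[𝕜] E}
    (hadd : ∀ t h u, A (t + h) u = A t (T h u) + A h u)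
    (hA : ∀ u, Tendsto (fun h : ℝ≥0 => ((h : ℝ) : 𝕜)⁻¹ • A h u) (𝓝[>] 0) (𝓝 u)) {u : E}
    (hu : ∀ t, T t u = u) : A 1 u = u := by
  have h0 : A 0 u = 0 := by simpa [hu] using hadd 0 0 u
  have hn : ∀ (n : ℕ) (h : ℝ≥0), A (n * h) u = (n : 𝕜) • A h u := by
    intro n h
    induction n with
    | zero => simp [h0]
    | succ n ih =>
      rw [Nat.cast_succ, add_mul, one_mul, hadd, hu, ih, Nat.cast_succ, add_smul, one_smul]
  have hlim : Tendsto (fun n : ℕ => (n + 1 : ℝ≥0)⁻¹) atTop (𝓝[>] 0) := by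
    refine tendsto_nhdsWithin_iff.2 ⟨?_, Eventually.of_forall fun n => by simp⟩
    rw [← NNReal.tendsto_coe]
    simpa using tendsto_one_div_add_atTop_nhds_zero_nat (𝕜 := ℝ)
  refine tendsto_nhds_unique ((tendsto_const_nhds (x := A 1 u)).congr fun n => ?_)
    ((hA u).comp hlim)
  have h1 := hn (n + 1) ((n + 1 : ℝ≥0)⁻¹)
  rw [Nat.cast_succ, mul_inv_cancel₀ (by positivity)] at h1
  rw [h1]
  simp

end IntegratedSemigroup

/-! ### Transfer of Fredholm properties -/

section Transfer

variable {𝕜 : Type*} [RCLike 𝕜]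

/-- Between Banach spaces over `ℝ` or `ℂ`, the topological conditions on strictness and on the
complementation of the kernel in `ContinuousLinearMap.IsFredholm` are automatic. -/
theorem ContinuousLinearMap.isFredholm_iff_of_completeSpace {E F : Type*} [NormedAddCommGroup E]
    [NormedSpace 𝕜 E] [CompleteSpace E] [NormedAddCommGroup F] [NormedSpace 𝕜 F] [CompleteSpace F]
    (D : E →L[𝕜] F) :
    D.IsFredholm ↔ IsClosed (LinearMap.range D.toLinearMap : Set F) ∧
      FiniteDimensional 𝕜 (LinearMap.ker D.toLinearMap) ∧
      FiniteDimensional 𝕜 (F ⧸ LinearMap.range D.toLinearMap) := by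
  refine ⟨fun h => ⟨h.isClosed_range, h.finite_ker, h.finite_coker⟩, fun ⟨h1, h2, h3⟩ =>
    ⟨?_, h1, h2, h3, Submodule.ClosedComplemented.of_finiteDimensional _⟩⟩
  have : CompleteSpace (LinearMap.range D.toLinearMap) := h1.completeSpace_coe
  have hs : Function.Surjective D.rangeRestrict := D.toLinearMap.surjective_rangeRestrict
  exact (D.rangeRestrict.isQuotientMap hs)

/-- Closedness of the range, dimensions of kernel and cokernel, and hence the Fredholm property and
the index, transfer from `G` to `D` along bounded maps `N` and `Q` that are inverse to each other on
the cokernels, once the kernels are isomorphic. -/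
theorem fredholm_transfer {E S : Type*} [NormedAddCommGroup E] [NormedSpace 𝕜 E]
    [NormedAddCommGroup S] [NormedSpace 𝕜 S] [CompleteSpace S] {G : E →ₗ.[𝕜] E} {D : S →L[𝕜] S}
    (hG : G.IsClosed) (N : E →L[𝕜] S) (Q : S →L[𝕜] E)
    (hNQ : ∀ y, N (Q y) = y - D y)
    (hN : ∀ f, f ∈ LinearMap.range G.toFun ↔ N f ∈ LinearMap.range D.toLinearMap)
    (e : LinearMap.ker G.toFun ≃ₗ[𝕜] LinearMap.ker D.toLinearMap) :
    ∃ _ : (E ⧸ LinearMap.range G.toFun) ≃ₗ[𝕜] (S ⧸ LinearMap.range D.toLinearMap),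
    (IsClosed (LinearMap.range G.toFun : Set E) ↔
      IsClosed (LinearMap.range D.toLinearMap : Set S)) ∧
    (IsFredholmPMap G ↔ D.IsFredholm) ∧ G.toFun.index = D.toLinearMap.index := by
  have hQ : ∀ y, y ∈ LinearMap.range D.toLinearMap ↔ Q y ∈ LinearMap.range G.toFun := by
    intro y
    rw [hN, hNQ, Submodule.sub_mem_iff_left]
    exact ⟨y, rfl⟩
  have hcl : IsClosed (LinearMap.range G.toFun : Set E) ↔
      IsClosed (LinearMap.range D.toLinearMap : Set S) := by
    constructor
    · intro h
      convert h.preimage Q.continuous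
      ext y; exact hQ y
    · intro h
      convert h.preimage N.continuous
      ext y; exact hN y
  have hc : LinearMap.range G.toFun =
      (LinearMap.range D.toLinearMap).comap N.toLinearMap := by
    ext f; exact hN f
  let φ := (LinearMap.range G.toFun).mapQ (LinearMap.range D.toLinearMap) N.toLinearMap hc.le
  have hφ : Function.Bijective φ := by
    constructor
    · rw [← LinearMap.ker_eq_bot, Submodule.ker_mapQ, ← hc, Submodule.mkQ_map_self]
    · intro y
      obtain ⟨y, rfl⟩ := Submodule.mkQ_surjective _ y
      refine ⟨Submodule.Quotient.mk (Q y), ?_⟩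
      simp only [φ, Submodule.mapQ_apply, Submodule.mkQ_apply]
      rw [Submodule.Quotient.eq]
      refine ⟨-y, ?_⟩
      simp [hNQ]
  let c := LinearEquiv.ofBijective φ hφ
  refine ⟨c, hcl, ?_, ?_⟩
  · rw [D.isFredholm_iff_of_completeSpace]
    constructor
    · rintro ⟨-, h1, h2, h3⟩
      exact ⟨hcl.1 h1, e.finiteDimensional, c.finiteDimensional⟩
    · rintro ⟨h1, h2, h3⟩
      exact ⟨hG, hcl.2 h1, e.symm.finiteDimensional, c.symm.finiteDimensional⟩
  · rw [LinearMap.index_eq_finrank_sub, LinearMap.index_eq_finrank_sub, e.finrank_eq, c.finrank_eq]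

end Transfer

/-! ### Mild solutions and their values at the integers -/

namespace EvolutionFamily

variable {𝕜 : Type*} {X : Type*} [RCLike 𝕜] [NormedAddCommGroup X] [NormedSpace 𝕜 X]
  [NormedSpace ℝ X]

/-- The average over `τ ∈ [r - 1, r]` of the value at time `r` of the solution of `𝐆 u = f`
prescribed by its value at time `τ`. It replaces the point value `u(r)`, which has no meaning for
an element of `L_p`. -/
noncomputable def meanValue (V : EvolutionFamily 𝕜 X) (u f : ℝ → X) (r : ℝ) : X :=
  (∫ τ in (r - 1)..r, V.prop r τ (u τ)) - ∫ τ in (r - 1)..r, ∫ s in τ..r, V.prop r s (f s)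

/-- Only the relation `T^1 u = u + A_1 f` between times at distance one enters. -/
theorem meanValue_sub_prop [CompleteSpace X] (V : EvolutionFamily 𝕜 X) {u f : ℝ → X}
    (hu : LocallyIntegrable u) (hf : LocallyIntegrable f)
    (h : ∀ᵐ τ, V.prop τ (τ - 1) (u (τ - 1)) = u τ + ∫ s in (τ - 1)..τ, V.prop τ s (f s)) (r : ℝ) :
    V.meanValue u f r - V.prop r (r - 1) (V.meanValue u f (r - 1)) =
      -∫ s in (r - 1)..r, V.prop r s (f s) := by
  have hpr : r - 1 ≤ r := by linarith
  have hc : ∀ a b : ℝ, IntervalIntegrable (fun τ => ∫ s in τ..r, V.prop r s (f s)) volume a b :=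
    fun a b => (V.continuous_integral_prop_comp hf continuous_const continuous_id
      continuous_const).intervalIntegrable _ _
  have hc' : ∀ a b : ℝ,
      IntervalIntegrable (fun τ => ∫ s in τ..(r - 1), V.prop (r - 1) s (f s)) volume a b :=
    fun a b => (V.continuous_integral_prop_comp hf continuous_const continuous_id
      continuous_const).intervalIntegrable _ _
  have e1 : V.prop r (r - 1) (∫ τ in (r - 1 - 1)..(r - 1), V.prop (r - 1) τ (u τ)) =
      (∫ τ in (r - 1)..r, V.prop r τ (u τ)) +
        ∫ τ in (r - 1)..r, ∫ s in (τ - 1)..τ, V.prop r s (f s) := by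
    have hc1 : Continuous fun τ => ∫ s in (τ - 1)..τ, V.prop r s (f s) :=
      V.continuous_integral_prop_comp hf continuous_const (by fun_prop) continuous_id
    rw [V.prop_integral hu (by linarith) le_rfl hpr,
      ← V.integral_prop_shift u zero_le_one hpr le_rfl,
      ← intervalIntegral.integral_add (V.intervalIntegrable_prop hu _ _ _)
        (hc1.intervalIntegrable _ _)]
    refine intervalIntegral.integral_congr_ae (h.mono fun τ hτ hmem => ?_)
    rw [Set.uIoc_of_le hpr] at hmem
    rw [hτ, map_add, V.prop_integral hf (by linarith) le_rfl hmem.2]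
  have e2 : V.prop r (r - 1) (∫ τ in (r - 1 - 1)..(r - 1),
      ∫ s in τ..(r - 1), V.prop (r - 1) s (f s)) =
        ∫ τ in (r - 1)..r, ∫ s in (τ - 1)..(r - 1), V.prop r s (f s) := by
    rw [← ContinuousLinearMap.intervalIntegral_comp_comm _ (hc' _ _),
      ← intervalIntegral.integral_comp_sub_right]
    refine intervalIntegral.integral_congr fun τ hτ => ?_
    rw [Set.uIcc_of_le hpr] at hτ
    exact V.prop_integral hf (by linarith [hτ.2]) le_rfl hpr
  have e3 : (∫ τ in (r - 1)..r, ∫ s in τ..r, V.prop r s (f s)) +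
      (∫ τ in (r - 1)..r, ∫ s in (τ - 1)..τ, V.prop r s (f s)) -
      (∫ τ in (r - 1)..r, ∫ s in (τ - 1)..(r - 1), V.prop r s (f s)) =
      ∫ s in (r - 1)..r, V.prop r s (f s) := by
    have hc1 : Continuous fun τ => ∫ s in (τ - 1)..τ, V.prop r s (f s) :=
      V.continuous_integral_prop_comp hf continuous_const (by fun_prop) continuous_id
    have hc2 : Continuous fun τ => ∫ s in (τ - 1)..(r - 1), V.prop r s (f s) :=
      V.continuous_integral_prop_comp hf continuous_const (by fun_prop) continuous_const
    rw [← intervalIntegral.integral_add (hc _ _) (hc1.intervalIntegrable _ _),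
      ← intervalIntegral.integral_sub ((hc _ _).add (hc1.intervalIntegrable _ _))
        (hc2.intervalIntegrable _ _)]
    -- the integrand no longer depends on `τ`, and the interval has length one
    rw [intervalIntegral.integral_congr (g := fun _ => ∫ s in (r - 1)..r, V.prop r s (f s))]
    · simp
    · intro τ _
      have h1 := V.integral_prop_add_adjacent hf r (τ - 1) τ r
      have h2 := V.integral_prop_add_adjacent hf r (τ - 1) (r - 1) r
      simp only
      rw [add_comm, h1, ← h2, add_sub_cancel_left]
  rw [meanValue, meanValue, map_sub, e1, e2, ← e3]
  abel

theorem norm_integral_integral_prop_le (V : EvolutionFamily 𝕜 X) {C : ℝ}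
    (hC : ∀ t s : ℝ, t - s ≤ 1 → ‖V.prop t s‖ ≤ C) {f : ℝ → X} (hf : LocallyIntegrable f) (r : ℝ) :
    ‖∫ τ in (r - 1)..r, ∫ s in τ..r, V.prop r s (f s)‖ ≤ C * ∫ s in (r - 1)..r, ‖f s‖ := by
  have hpr : r - 1 ≤ r := by linarith
  have hC0 : 0 ≤ C := (norm_nonneg _).trans (hC 0 0 (by simp))
  refine (intervalIntegral.norm_integral_le_of_norm_le_const
    (C := C * ∫ s in (r - 1)..r, ‖f s‖) fun τ hτ => ?_).trans (by simp)
  rw [Set.uIoc_of_le hpr] at hτ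
  refine (V.norm_integral_prop_le hC hf hτ.2 (by linarith [hτ.1])).trans ?_
  gcongr
  refine intervalIntegral.integral_mono_interval hτ.1.le hτ.2 le_rfl
    (Eventually.of_forall fun s => norm_nonneg _) hf.intervalIntegrable_real.norm

/-- The solution of `𝐆 u = f` that starts afresh from the value `x n` at each integer `n`. -/
noncomputable def orbit (V : EvolutionFamily 𝕜 X) (x : ℤ → X) (f : ℝ → X) (t : ℝ) : X :=
  V.prop t ⌊t⌋ (x ⌊t⌋) - ∫ s in (⌊t⌋ : ℝ)..t, V.prop t s (f s)

section Orbit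

variable [CompleteSpace X] (V : EvolutionFamily 𝕜 X) {x : ℤ → X} {f : ℝ → X}

/-- If the data at the integers are compatible, the pieces of `orbit` fit together to a single mild
solution, so `orbit` may be started at any earlier integer. -/
theorem orbit_eq_of_le (hf : LocallyIntegrable f)
    (hx : ∀ n : ℤ, x n - V.prop n (n - 1) (x (n - 1)) =
      -∫ s in ((n : ℝ) - 1)..n, V.prop n s (f s)) {m : ℤ} {t : ℝ} (hmt : (m : ℝ) ≤ t) :
    V.orbit x f t = V.prop t m (x m) - ∫ s in (m : ℝ)..t, V.prop t s (f s) := by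
  suffices H : ∀ n : ℤ, m ≤ n → (n : ℝ) ≤ t →
      V.prop t n (x n) - ∫ s in (n : ℝ)..t, V.prop t s (f s) =
        V.prop t m (x m) - ∫ s in (m : ℝ)..t, V.prop t s (f s) from
    H ⌊t⌋ (Int.le_floor.2 hmt) (Int.floor_le t)
  intro n hmn
  induction n, hmn using Int.leInduction with
  | base => exact fun _ => rfl
  | succ n hmn ih =>
    intro hnt
    have hn1 : ((n + 1 : ℤ) : ℝ) - 1 = n := by push_cast; ring
    have hle : (n : ℝ) ≤ ((n + 1 : ℤ) : ℝ) := by push_cast; linarith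
    have h1 := hx (n + 1)
    rw [hn1, add_sub_cancel_right, sub_eq_iff_eq_add] at h1
    rw [← ih (hle.trans hnt), h1, map_add, map_neg, V.prop_prop hle hnt,
      V.prop_integral hf hle le_rfl hnt,
      ← V.integral_prop_add_adjacent hf t n ((n + 1 : ℤ) : ℝ) t]
    abel

theorem orbit_mild (hf : LocallyIntegrable f)
    (hx : ∀ n : ℤ, x n - V.prop n (n - 1) (x (n - 1)) =
      -∫ s in ((n : ℝ) - 1)..n, V.prop n s (f s)) {r t : ℝ} (hrt : r ≤ t) :
    V.prop t r (V.orbit x f r) = V.orbit x f t + ∫ s in r..t, V.prop t s (f s) := by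
  have hm := Int.floor_le r
  rw [V.orbit_eq_of_le hf hx (hm.trans hrt), orbit, map_sub, V.prop_prop hm hrt,
    V.prop_integral hf hm le_rfl hrt, ← V.integral_prop_add_adjacent hf t ⌊r⌋ r t]
  abel

theorem continuous_orbit (hf : LocallyIntegrable f)
    (hx : ∀ n : ℤ, x n - V.prop n (n - 1) (x (n - 1)) =
      -∫ s in ((n : ℝ) - 1)..n, V.prop n s (f s)) : Continuous (V.orbit x f) := by
  refine continuous_iff_continuousAt.2 fun t₀ => ?_
  obtain ⟨m, hm⟩ := exists_int_lt t₀
  have h : Continuous fun t => V.prop t m (x m) - ∫ s in (m : ℝ)..t, V.prop t s (f s) :=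
    (V.continuous_prop_comp continuous_id continuous_const continuous_const).sub
      (V.continuous_integral_prop_comp hf continuous_id continuous_const continuous_id)
  refine h.continuousAt.congr ?_
  filter_upwards [lt_mem_nhds hm] with t ht
  exact (V.orbit_eq_of_le hf hx ht.le).symm

end Orbit

theorem norm_orbit_le (V : EvolutionFamily 𝕜 X) {C : ℝ}
    (hC : ∀ t s : ℝ, t - s ≤ 1 → ‖V.prop t s‖ ≤ C) {f : ℝ → X} (hf : LocallyIntegrable f)
    (x : ℤ → X) (t : ℝ) :
    ‖V.orbit x f t‖ ≤ C * (‖x ⌊t⌋‖ + ∫ s in (⌊t⌋ : ℝ)..(⌊t⌋ + 1), ‖f s‖) := by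
  have hC0 : 0 ≤ C := (norm_nonneg _).trans (hC 0 0 (by simp))
  have h1 := Int.floor_le t
  have h2 := Int.lt_floor_add_one t
  rw [mul_add]
  refine (norm_sub_le _ _).trans (add_le_add (V.norm_prop_le hC (by linarith) _) ?_)
  refine (V.norm_integral_prop_le hC hf h1 (by linarith)).trans ?_
  gcongr
  exact intervalIntegral.integral_mono_interval le_rfl h1 h2.le
    (Eventually.of_forall fun s => norm_nonneg _) hf.intervalIntegrable_real.norm

/-! ### Spreading a sequence over the unit cells -/

/-- A function on the line built from a sequence: on the cell `[n, n + 1)` it runs along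
`U(t, n) x_n`, weighted by the bump `6 r (1 - r)`, `r = t - n`, which has integral one and vanishes
at both ends of the cell, so that the pieces fit together continuously. -/
noncomputable def spread (V : EvolutionFamily 𝕜 X) (x : ℤ → X) (t : ℝ) : X :=
  (6 * Int.fract t * (1 - Int.fract t)) • V.prop t ⌊t⌋ (x ⌊t⌋)

theorem spread_of_mem_Icc (V : EvolutionFamily 𝕜 X) (x : ℤ → X) {n : ℤ} {t : ℝ}
    (ht : t ∈ Set.Icc (n : ℝ) (n + 1)) :
    V.spread x t = (6 * (t - n) * (1 - (t - n))) • V.prop t n (x n) := by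
  rcases ht.2.lt_or_eq with h | h
  · rw [spread, Int.fract, Int.floor_eq_iff.2 ⟨ht.1, h⟩]
  · have : Int.fract t = 0 := by rw [h]; simp
    rw [spread, this, h]
    simp

theorem continuous_spread (V : EvolutionFamily 𝕜 X) (x : ℤ → X) : Continuous (V.spread x) := by
  have hloc : LocallyFinite fun n : ℤ => Set.Icc (n : ℝ) (n + 1) := by
    intro t
    refine ⟨Set.Ioo (t - 1) (t + 1), Ioo_mem_nhds (by linarith) (by linarith),
      (Set.finite_Icc (⌊t⌋ - 3) (⌊t⌋ + 3)).subset ?_⟩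
    rintro n ⟨s, hs, hs'⟩
    have h1 := Int.floor_le t
    have h2 := Int.lt_floor_add_one t
    constructor
    · have : ((⌊t⌋ - 3 : ℤ) : ℝ) ≤ n := by push_cast; linarith [hs.2, hs'.1]
      exact_mod_cast this
    · have : (n : ℝ) ≤ ((⌊t⌋ + 3 : ℤ) : ℝ) := by push_cast; linarith [hs.1, hs'.2]
      exact_mod_cast this
  refine hloc.continuous (Set.iUnion_eq_univ_iff.2 fun t =>
    ⟨⌊t⌋, Int.floor_le t, (Int.lt_floor_add_one t).le⟩) (fun n => isClosed_Icc) fun n => ?_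
  refine ContinuousOn.congr (Continuous.continuousOn ?_) fun t ht => V.spread_of_mem_Icc x ht
  exact Continuous.smul (by fun_prop)
    (V.continuous_prop_comp continuous_id continuous_const continuous_const)

theorem norm_spread_le (V : EvolutionFamily 𝕜 X) {C : ℝ}
    (hC : ∀ t s : ℝ, t - s ≤ 1 → ‖V.prop t s‖ ≤ C) (x : ℤ → X) (t : ℝ) :
    ‖V.spread x t‖ ≤ 2 * C * ‖x ⌊t⌋‖ := by
  have h1 := Int.fract_nonneg t
  have h2 := Int.fract_lt_one t
  have h3 : t - ⌊t⌋ ≤ 1 := h2.le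
  rw [spread, norm_smul, mul_assoc 2 C]
  refine mul_le_mul ?_ (V.norm_prop_le hC h3 _) (norm_nonneg _) (by norm_num)
  rw [Real.norm_of_nonneg (by have : 0 ≤ 1 - Int.fract t := by linarith
                              positivity)]
  nlinarith [sq_nonneg (Int.fract t - 1 / 2)]

theorem integral_prop_spread [CompleteSpace X] (V : EvolutionFamily 𝕜 X) [IsScalarTower ℝ 𝕜 X]
    (x : ℤ → X) (n : ℤ) :
    ∫ s in ((n : ℝ) - 1)..n, V.prop n s (V.spread x s) = V.prop n (n - 1) (x (n - 1)) := by
  have hn : ((n : ℝ) - 1) ≤ n := by linarith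
  have h1 : ∫ s in ((n : ℝ) - 1)..n, V.prop n s (V.spread x s) =
      ∫ s in ((n : ℝ) - 1)..n, (6 * (s - (n - 1)) * (1 - (s - (n - 1)))) •
        V.prop n (n - 1) (x (n - 1)) := by
    refine intervalIntegral.integral_congr fun s hs => ?_
    rw [Set.uIcc_of_le hn] at hs
    have hs' : s ∈ Set.Icc (((n - 1 : ℤ)) : ℝ) (((n - 1 : ℤ) : ℝ) + 1) := by
      push_cast
      exact ⟨hs.1, by linarith [hs.2]⟩
    rw [V.spread_of_mem_Icc x hs', RCLike.real_smul_eq_coe_smul (K := 𝕜), map_smul,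
      V.prop_prop (by push_cast; exact hs.1) hs.2, ← RCLike.real_smul_eq_coe_smul (K := 𝕜)]
    push_cast
    rfl
  rw [h1, intervalIntegral.integral_smul_const,
    intervalIntegral.integral_comp_sub_right (fun r : ℝ => 6 * r * (1 - r))]
  have h2 : ∫ r in (0 : ℝ)..1, 6 * r * (1 - r) = 1 := by
    have : ∀ r : ℝ, 6 * r * (1 - r) = 6 * r - 6 * r ^ 2 := fun r => by ring
    simp_rw [this]
    rw [intervalIntegral.integral_sub (Continuous.intervalIntegrable (by fun_prop) _ _)
      (Continuous.intervalIntegrable (by fun_prop) _ _), intervalIntegral.integral_const_mul,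
      intervalIntegral.integral_const_mul, integral_id, integral_pow]
    norm_num
  have e1 : (n : ℝ) - 1 - (n - 1) = 0 := by ring
  have e2 : (n : ℝ) - (n - 1) = 1 := by ring
  rw [e1, e2, h2, one_smul]

end EvolutionFamily

/-! ### Function spaces with a cell structure -/

/-- A functional, additive, homogeneous and bounded relation is the graph of a bounded operator. -/
theorem exists_continuousLinearMap_of_rel {𝕜 E F : Type*} [RCLike 𝕜] [NormedAddCommGroup E]
    [NormedSpace 𝕜 E] [NormedAddCommGroup F] [NormedSpace 𝕜 F] {P : E → F → Prop}
    (huniq : ∀ u v w, P u v → P u w → v = w)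
    (hadd : ∀ u v u' v', P u u' → P v v' → P (u + v) (u' + v'))
    (hsmul : ∀ (c : 𝕜) u u', P u u' → P (c • u) (c • u'))
    {C : ℝ} (hC : ∀ u, ∃ v, P u v ∧ ‖v‖ ≤ C * ‖u‖) :
    ∃ L : E →L[𝕜] F, ∀ u, P u (L u) := by
  choose L hL hb using hC
  exact ⟨LinearMap.mkContinuous
    { toFun := L
      map_add' := fun u v => huniq _ _ _ (hL _) (hadd _ _ _ _ (hL u) (hL v))
      map_smul' := fun c u => huniq _ _ _ (hL _) (hsmul c _ _ (hL u)) } C hb, hL⟩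

section Model

variable {𝕜 X : Type*} [RCLike 𝕜] [NormedAddCommGroup X] [NormedSpace 𝕜 X]

/-- A normed space `E` of (classes of) functions on the line and a normed space `S` of sequences,
carrying the evolution semigroup `T` and the difference operator `D` of `V`, and matched to each
other on the unit cells of the line: membership of a function or a sequence follows from pointwise
domination by the data of elements of `E` and `S` on these cells. The pairs
`(L_p(ℝ; X), ℓ_p(ℤ; X))` and `(C₀(ℝ; X), c₀(ℤ; X))` are the intended instances. -/
structure CellModel (V : EvolutionFamily 𝕜 X) {E S : Type*} [NormedAddCommGroup E]
    [NormedSpace 𝕜 E] [NormedAddCommGroup S] [NormedSpace 𝕜 S] (T : ℝ≥0 → E →L[𝕜] E)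
    (D : S →L[𝕜] S) where
  /-- A representative of an element of `E`. -/
  eval : E → ℝ → X
  /-- The sequence that an element of `S` is. -/
  seq : S → ℤ → X
  locallyIntegrable : ∀ u, LocallyIntegrable (eval u)
  eval_ext : ∀ u v, eval u =ᵐ[volume] eval v → u = v
  eval_add : ∀ u v, eval (u + v) =ᵐ[volume] eval u + eval v
  eval_smul : ∀ (c : 𝕜) u, eval (c • u) =ᵐ[volume] c • eval u
  seq_ext : ∀ x y, seq x = seq y → x = y
  seq_add : ∀ x y, seq (x + y) = seq x + seq y
  seq_smul : ∀ (c : 𝕜) x, seq (c • x) = c • seq x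
  /-- `T` is the evolution semigroup. -/
  eval_semigroup : ∀ t u, eval (T t u) =ᵐ[volume] fun τ : ℝ => V.prop τ (τ - t) (eval u (τ - t))
  /-- `D` is the difference operator. -/
  seq_difference : ∀ x (n : ℤ), seq (D x) n = seq x n - V.prop n (n - 1) (seq x (n - 1))
  /-- A sequence dominated by the integrals over unit cells of an element of `E` lies in `S`. -/
  exists_seq : ∀ (y : ℤ → X) (u : E) (C : ℝ), 0 ≤ C →
    (∀ n : ℤ, ‖y n‖ ≤ C * ∫ s in ((n : ℝ) - 1)..n, ‖eval u s‖) →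
      ∃ x, seq x = y ∧ ‖x‖ ≤ C * ‖u‖
  /-- A continuous function dominated on each unit cell by the data of an element of `S` and one of
  `E` lies in `E`. -/
  exists_eval : ∀ (w : ℝ → X) (x : S) (f : E) (C : ℝ), 0 ≤ C → Continuous w →
    (∀ t : ℝ, ‖w t‖ ≤ C * (‖seq x ⌊t⌋‖ + ∫ s in (⌊t⌋ : ℝ)..(⌊t⌋ + 1), ‖eval f s‖)) →
      ∃ v, eval v =ᵐ[volume] w ∧ ‖v‖ ≤ C * (‖x‖ + ‖f‖)
  /-- A continuous function dominated by integrals of an element of `E` over a moving window of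
  length `h` lies in `E`, with the factor `h` in the norm estimate. -/
  exists_window : ∀ (h : ℝ≥0) (w : ℝ → X) (f : E) (C : ℝ), 0 ≤ C → Continuous w →
    (∀ t : ℝ, ‖w t‖ ≤ C * ∫ s in (t - h)..t, ‖eval f s‖) →
      ∃ v, eval v =ᵐ[volume] w ∧ ‖v‖ ≤ C * h * ‖f‖

namespace CellModel

variable {V : EvolutionFamily 𝕜 X} {E S : Type*} [NormedAddCommGroup E]
    [NormedSpace 𝕜 E] [NormedAddCommGroup S] [NormedSpace 𝕜 S] {T : ℝ≥0 → E →L[𝕜] E}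
    {D : S →L[𝕜] S} (M : CellModel V T D)

theorem seq_zero : M.seq 0 = 0 := by simpa using M.seq_smul 0 0

theorem eval_zero : M.eval 0 =ᵐ[volume] 0 := by simpa using M.eval_smul 0 0

theorem seq_sub (x y : S) : M.seq (x - y) = M.seq x - M.seq y := by
  rw [eq_sub_iff_add_eq, ← M.seq_add, sub_add_cancel]

theorem seq_neg (x : S) : M.seq (-x) = -M.seq x := by
  rw [← zero_sub, M.seq_sub, M.seq_zero, zero_sub]

variable [NormedSpace ℝ X]

theorem integral_prop_eval_add (u v : E) (t a b : ℝ) :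
    ∫ s in a..b, V.prop t s (M.eval (u + v) s) =
      (∫ s in a..b, V.prop t s (M.eval u s)) + ∫ s in a..b, V.prop t s (M.eval v s) := by
  rw [V.integral_prop_congr (M.eval_add u v), ← intervalIntegral.integral_add
    (V.intervalIntegrable_prop (M.locallyIntegrable u) _ _ _)
    (V.intervalIntegrable_prop (M.locallyIntegrable v) _ _ _)]
  simp

theorem exists_integrated {h : ℝ≥0} {C : ℝ} (hC : ∀ t s : ℝ, t - s ≤ h → ‖V.prop t s‖ ≤ C)
    (u : E) : ∃ v, (M.eval v =ᵐ[volume]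
      fun τ : ℝ => ∫ s in (τ - h)..τ, V.prop τ s (M.eval u s)) ∧ ‖v‖ ≤ C * h * ‖u‖ := by
  refine M.exists_window h _ u C ((norm_nonneg _).trans (hC 0 0 (by simp)))
    (V.continuous_integral_prop_comp (M.locallyIntegrable u) continuous_id (by fun_prop)
      continuous_id) fun t => ?_
  exact V.norm_integral_prop_le hC (M.locallyIntegrable u) (by simp) (by simp)

theorem integral_prop_semigroup (h : ℝ≥0) (u : E) {t a b : ℝ} (ha : a ≤ t) (hb : b ≤ t) :
    ∫ s in a..b, V.prop t s (M.eval (T h u) s) =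
      ∫ s in (a - h)..(b - h), V.prop t s (M.eval u s) := by
  rw [V.integral_prop_congr (M.eval_semigroup h u), V.integral_prop_shift _ h.coe_nonneg ha hb]

variable [IsScalarTower ℝ 𝕜 X]

theorem integral_prop_eval_smul (c : 𝕜) (u : E) (t a b : ℝ) :
    ∫ s in a..b, V.prop t s (M.eval (c • u) s) = c • ∫ s in a..b, V.prop t s (M.eval u s) := by
  rw [V.integral_prop_congr (M.eval_smul c u), ← intervalIntegral.integral_smul]
  simp

theorem exists_integratedCLM (h : ℝ≥0) : ∃ A : E →L[𝕜] E, ∀ u,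
    M.eval (A u) =ᵐ[volume] fun τ : ℝ => ∫ s in (τ - h)..τ, V.prop τ s (M.eval u s) := by
  obtain ⟨C, hC0, hC⟩ := V.exists_prop_bound h
  refine exists_continuousLinearMap_of_rel
    (P := fun u v => M.eval v =ᵐ[volume] fun τ : ℝ => ∫ s in (τ - h)..τ, V.prop τ s (M.eval u s))
    (fun u v w hv hw => M.eval_ext _ _ (hv.trans hw.symm)) (fun u v u' v' hu hv => ?_)
    (fun c u u' hu => ?_) (M.exists_integrated hC)
  · filter_upwards [M.eval_add u' v', hu, hv] with τ h1 h2 h3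
    rw [h1, Pi.add_apply, h2, h3, M.integral_prop_eval_add]
  · filter_upwards [M.eval_smul c u', hu] with τ h1 h2
    rw [h1, Pi.smul_apply, h2, M.integral_prop_eval_smul]

/-- The integrated evolution semigroup `(A_h u)(τ) = ∫_{τ - h}^τ U(τ, s) u(s) ds`, that is,
`A_h = ∫_0^h T^s ds`. -/
noncomputable def integrated (h : ℝ≥0) : E →L[𝕜] E := (M.exists_integratedCLM h).choose

theorem eval_integrated (h : ℝ≥0) (u : E) : M.eval (M.integrated h u) =ᵐ[volume]
    fun τ : ℝ => ∫ s in (τ - h)..τ, V.prop τ s (M.eval u s) :=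
  (M.exists_integratedCLM h).choose_spec u

theorem exists_norm_integrated_le : ∃ C : ℝ, 0 ≤ C ∧ ∀ h : ℝ≥0, h ≤ 1 → ∀ u,
    ‖M.integrated h u‖ ≤ C * h * ‖u‖ := by
  obtain ⟨C, hC0, hC⟩ := V.exists_prop_bound 1
  refine ⟨C, hC0, fun h hh u => ?_⟩
  obtain ⟨v, hv, hn⟩ := M.exists_integrated (h := h)
    (fun t s hts => hC t s (hts.trans (by exact_mod_cast hh))) u
  rwa [M.eval_ext _ _ ((M.eval_integrated h u).trans hv.symm)]

/-- Since `h⁻¹ A_h` is bounded uniformly in `h ≤ 1`, its strong convergence to the identity need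
only be checked on a dense set. -/
theorem tendsto_integrated_of_dense (h : Dense {u : E |
      Tendsto (fun h : ℝ≥0 => ((h : ℝ) : 𝕜)⁻¹ • M.integrated h u) (𝓝[>] 0) (𝓝 u)}) (u : E) :
    Tendsto (fun h : ℝ≥0 => ((h : ℝ) : 𝕜)⁻¹ • M.integrated h u) (𝓝[>] 0) (𝓝 u) := by
  obtain ⟨C, hC0, hC⟩ := M.exists_norm_integrated_le
  rw [Metric.tendsto_nhds]
  intro ε hε
  obtain ⟨v, hv, huv⟩ := Metric.dense_iff.1 h u (ε / (2 * (C + 2))) (by positivity)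
  have hv' := Metric.tendsto_nhds.1 huv (ε / 2) (by positivity)
  have h1 : ∀ᶠ h : ℝ≥0 in 𝓝[>] 0, h ≤ 1 :=
    mem_nhdsWithin_of_mem_nhds (Iic_mem_nhds zero_lt_one)
  filter_upwards [hv', h1, self_mem_nhdsWithin] with h hd hh h0
  have h0' : (0 : ℝ) < h := h0
  rw [dist_eq_norm] at hd ⊢
  rw [Metric.mem_ball, dist_eq_norm] at hv
  have e : ((h : ℝ) : 𝕜)⁻¹ • M.integrated h u - u =
      (((h : ℝ) : 𝕜)⁻¹ • M.integrated h v - v) + (v - u) -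
        ((h : ℝ) : 𝕜)⁻¹ • M.integrated h (v - u) := by
    rw [map_sub, smul_sub]; abel
  have h2 : ‖((h : ℝ) : 𝕜)⁻¹ • M.integrated h (v - u)‖ ≤ C * ‖v - u‖ := by
    rw [norm_smul, norm_inv, RCLike.norm_ofReal, abs_of_pos h0', inv_mul_le_iff₀ h0']
    refine (hC h hh _).trans (le_of_eq (by ring))
  rw [e]
  calc _ ≤ ‖((h : ℝ) : 𝕜)⁻¹ • M.integrated h v - v‖ + ‖v - u‖ + C * ‖v - u‖ :=
        (norm_sub_le _ _).trans (add_le_add (norm_add_le _ _) h2)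
    _ = ‖((h : ℝ) : 𝕜)⁻¹ • M.integrated h v - v‖ + (C + 1) * ‖v - u‖ := by ring
    _ < ε / 2 + (C + 2) * (ε / (2 * (C + 2))) := by
        refine add_lt_add_of_lt_of_le hd ?_
        gcongr
        linarith
    _ = ε := by field_simp; ring

theorem exists_sampling : ∃ N : E →L[𝕜] S, ∀ u (n : ℤ),
    M.seq (N u) n = ∫ s in ((n : ℝ) - 1)..n, V.prop n s (M.eval u s) := by
  obtain ⟨C, hC0, hC⟩ := V.exists_prop_bound 1
  refine exists_continuousLinearMap_of_rel (P := fun u x => ∀ n : ℤ,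
      M.seq x n = ∫ s in ((n : ℝ) - 1)..n, V.prop n s (M.eval u s))
    (fun u v w hv hw => M.seq_ext _ _ (funext fun n => (hv n).trans (hw n).symm))
    (fun u v u' v' hu hv n => ?_) (fun c u u' hu n => ?_) (C := C) fun u => ?_
  · rw [M.seq_add, Pi.add_apply, hu, hv, M.integral_prop_eval_add]
  · rw [M.seq_smul, Pi.smul_apply, hu, M.integral_prop_eval_smul]
  · obtain ⟨x, hx, hn⟩ := M.exists_seq
      (fun n => ∫ s in ((n : ℝ) - 1)..n, V.prop n s (M.eval u s)) u C hC0
      fun n => V.norm_integral_prop_le hC (M.locallyIntegrable u) (by simp) (by simp)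
    exact ⟨x, fun n => by rw [hx], hn⟩

/-- The sampling operator `(N u)_n = ∫_{n - 1}^n U(n, s) u(s) ds`. -/
noncomputable def sampling : E →L[𝕜] S := M.exists_sampling.choose

theorem seq_sampling (u : E) (n : ℤ) :
    M.seq (M.sampling u) n = ∫ s in ((n : ℝ) - 1)..n, V.prop n s (M.eval u s) :=
  M.exists_sampling.choose_spec u n

theorem exists_spreading : ∃ Q : S →L[𝕜] E, ∀ x, M.eval (Q x) =ᵐ[volume] V.spread (M.seq x) := by
  obtain ⟨C, hC0, hC⟩ := V.exists_prop_bound 1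
  refine exists_continuousLinearMap_of_rel (P := fun x u => M.eval u =ᵐ[volume] V.spread (M.seq x))
    (fun x v w hv hw => M.eval_ext _ _ (hv.trans hw.symm)) (fun x y u v hu hv => ?_)
    (fun c x u hu => ?_) (C := 2 * C) fun x => ?_
  · filter_upwards [M.eval_add u v, hu, hv] with t h1 h2 h3
    rw [h1, Pi.add_apply, h2, h3, M.seq_add]
    simp [EvolutionFamily.spread]
  · filter_upwards [M.eval_smul c u, hu] with t h1 h2
    rw [h1, Pi.smul_apply, h2, M.seq_smul]
    simp only [EvolutionFamily.spread, Pi.smul_apply, map_smul]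
    rw [smul_comm]
  · simpa using M.exists_eval (V.spread (M.seq x)) x 0 (2 * C) (by positivity)
      (V.continuous_spread _) fun t => (V.norm_spread_le hC _ t).trans (by
        gcongr
        exact le_add_of_nonneg_right (intervalIntegral.integral_nonneg (by simp)
          fun s _ => norm_nonneg _))

/-- The bounded operator that spreads a sequence over the unit cells of the line. It is inverse to
sampling modulo the range of `D`. -/
noncomputable def spreading : S →L[𝕜] E := M.exists_spreading.choose

theorem eval_spreading (x : S) : M.eval (M.spreading x) =ᵐ[volume] V.spread (M.seq x) :=
  M.exists_spreading.choose_spec x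

theorem integrated_add (t h : ℝ≥0) (u : E) :
    M.integrated (t + h) u = M.integrated t (T h u) + M.integrated h u := by
  refine M.eval_ext _ _ ?_
  filter_upwards [M.eval_integrated (t + h) u, M.eval_add (M.integrated t (T h u))
    (M.integrated h u), M.eval_integrated t (T h u), M.eval_integrated h u] with τ h1 h2 h3 h4
  rw [h1, h2, Pi.add_apply, h3, h4, M.integral_prop_semigroup h u (by simp) le_rfl,
    V.integral_prop_add_adjacent (M.locallyIntegrable u)]
  congr 1
  push_cast
  ring

section Cell

variable [CompleteSpace X]

theorem integrated_add' (t h : ℝ≥0) (u : E) :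
    M.integrated (t + h) u = M.integrated t u + T t (M.integrated h u) := by
  refine M.eval_ext _ _ ?_
  filter_upwards [M.eval_integrated (t + h) u, M.eval_add (M.integrated t u)
    (T t (M.integrated h u)), M.eval_integrated t u, M.eval_semigroup t (M.integrated h u),
    EvolutionFamily.ae_comp_sub (t : ℝ) (M.eval_integrated h u)] with τ h1 h2 h3 h4 h5
  rw [h1, h2, Pi.add_apply, h3, h4, h5, V.prop_integral (M.locallyIntegrable u) (by simp) le_rfl
    (by simp), add_comm (∫ s in (τ - t)..τ, _),
    V.integral_prop_add_adjacent (M.locallyIntegrable u)]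
  congr 1
  push_cast
  ring

theorem sampling_spreading (x : S) : M.sampling (M.spreading x) = x - D x := by
  refine M.seq_ext _ _ (funext fun n => ?_)
  rw [M.seq_sampling, V.integral_prop_congr (M.eval_spreading x),
    V.integral_prop_spread, M.seq_sub, Pi.sub_apply, M.seq_difference, sub_sub_cancel]

/-- A solution of `T^1 u - u = A_1 f` yields a sequence `x` with `D x = -N f`: the mean values of
the solution at the integers. -/
theorem exists_difference_eq_of_semigroup {u f : E} (h : T 1 u - u = M.integrated 1 f) :
    ∃ x, D x = -M.sampling f := by
  obtain ⟨C, hC0, hC⟩ := V.exists_prop_bound 1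
  obtain ⟨y, hy, -⟩ := M.exists_seq
    (fun n => ∫ τ in ((n : ℝ) - 1)..n, ∫ s in τ..n, V.prop n s (M.eval f s)) f C hC0
    fun n => V.norm_integral_integral_prop_le hC (M.locallyIntegrable f) n
  have hx : ∀ n : ℤ, M.seq (M.sampling u - y) n = V.meanValue (M.eval u) (M.eval f) n := by
    intro n
    rw [M.seq_sub, Pi.sub_apply, M.seq_sampling, hy, EvolutionFamily.meanValue]
  refine ⟨M.sampling u - y, M.seq_ext _ _ (funext fun n => ?_)⟩
  rw [M.seq_difference, hx, hx, M.seq_neg, Pi.neg_apply, M.seq_sampling,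
    ← V.meanValue_sub_prop (M.locallyIntegrable u) (M.locallyIntegrable f)]
  · push_cast; rfl
  · rw [sub_eq_iff_eq_add] at h
    filter_upwards [M.eval_semigroup 1 u, M.eval_add (M.integrated 1 f) u,
      M.eval_integrated 1 f] with τ h1 h2 h3
    rw [NNReal.coe_one] at h1 h3
    rw [← h1, h, h2, Pi.add_apply, h3, add_comm]

/-- Conversely, a sequence `x` with `D x = -N f` extends to a solution of `𝐆 u = f`. -/
theorem exists_orbit {x : S} {f : E} (h : D x = -M.sampling f) :
    ∃ u, (M.eval u =ᵐ[volume] V.orbit (M.seq x) (M.eval f)) ∧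
      ∀ t, T t u - u = M.integrated t f := by
  obtain ⟨C, hC0, hC⟩ := V.exists_prop_bound 1
  have hf := M.locallyIntegrable f
  have hx : ∀ n : ℤ, M.seq x n - V.prop n (n - 1) (M.seq x (n - 1)) =
      -∫ s in ((n : ℝ) - 1)..n, V.prop n s (M.eval f s) := fun n => by
    rw [← M.seq_difference, h, M.seq_neg, Pi.neg_apply, M.seq_sampling]
  obtain ⟨u, hu, -⟩ := M.exists_eval _ x f C hC0 (V.continuous_orbit hf hx)
    (V.norm_orbit_le hC hf _)
  refine ⟨u, hu, fun t => ?_⟩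
  rw [sub_eq_iff_eq_add]
  refine M.eval_ext _ _ ?_
  filter_upwards [hu, EvolutionFamily.ae_comp_sub (t : ℝ) hu, M.eval_semigroup t u,
    M.eval_add (M.integrated t f) u, M.eval_integrated t f] with τ h1 h2 h3 h4 h5
  rw [h3, h2, h4, Pi.add_apply, h5, h1, V.orbit_mild hf hx (by simp), add_comm]

/-- If `T^1 u = u`, then `A_1 u` is determined by the samples of `u`: at the point `t` it is the
propagation to time `t` of the sample at `⌊t⌋`. -/
theorem integrated_one_eq_zero {u : E} (hu : T 1 u = u) (hN : M.sampling u = 0) :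
    M.integrated 1 u = 0 := by
  refine M.eval_ext _ _ ?_
  filter_upwards [M.eval_integrated 1 u, M.eval_zero] with t h1 h2
  have hf := M.locallyIntegrable u
  have hn := Int.floor_le t
  have e1 : ∫ s in ((⌊t⌋ : ℝ) - 1)..⌊t⌋, V.prop t s (M.eval u s) = 0 := by
    rw [← V.prop_integral hf (by simp) le_rfl hn, ← M.seq_sampling, hN, M.seq_zero]
    simp
  have e2 : ∫ s in (⌊t⌋ : ℝ)..t, V.prop t s (M.eval u s) =
      ∫ s in ((⌊t⌋ : ℝ) - 1)..(t - 1), V.prop t s (M.eval u s) := by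
    have := M.integral_prop_semigroup 1 u hn le_rfl
    rwa [hu, NNReal.coe_one] at this
  have e3 := V.integral_prop_add_adjacent hf t (⌊t⌋ - 1) (t - 1) t
  have e4 := V.integral_prop_add_adjacent hf t (⌊t⌋ - 1) ⌊t⌋ t
  rw [h1, h2, NNReal.coe_one, Pi.zero_apply]
  rw [e1, e2, zero_add, ← e3, left_eq_add] at e4
  exact e4

variable (hA : ∀ u, Tendsto (fun h : ℝ≥0 => ((h : ℝ) : 𝕜)⁻¹ • M.integrated h u) (𝓝[>] 0) (𝓝 u))
include hA

theorem mem_graph_iff (u f : E) :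
    (u, f) ∈ (semigroupGenerator T).graph ↔ ∀ t, T t u - u = M.integrated t f :=
  mem_graph_semigroupGenerator_iff
    (fun t h u => by rw [← M.integrated_add, M.integrated_add']) hA u f

theorem isClosed_generator : (semigroupGenerator T).IsClosed := by
  have : ((semigroupGenerator T).graph : Set (E × E)) =
      ⋂ t, {q | T t q.1 - q.1 = M.integrated t q.2} := by
    ext ⟨u, f⟩
    simp only [SetLike.mem_coe, M.mem_graph_iff hA, Set.mem_iInter, Set.mem_ofPred_eq]
  rw [LinearPMap.IsClosed, this]
  exact isClosed_iInter fun t => isClosed_eq (by fun_prop) (by fun_prop)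

theorem mem_range_generator_iff (f : E) :
    f ∈ LinearMap.range (semigroupGenerator T).toFun ↔
      M.sampling f ∈ LinearMap.range D.toLinearMap := by
  have hr : f ∈ LinearMap.range (semigroupGenerator T).toFun ↔
      ∃ u, (u, f) ∈ (semigroupGenerator T).graph := by
    constructor
    · rintro ⟨u, rfl⟩
      exact ⟨u, LinearPMap.mem_graph _ u⟩
    · rintro ⟨u, hu⟩
      obtain ⟨y, -, hy⟩ := (LinearPMap.mem_graph_iff _).1 hu
      exact ⟨y, hy⟩
  rw [hr, ← Submodule.neg_mem_iff]
  constructor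
  · rintro ⟨u, hu⟩
    exact M.exists_difference_eq_of_semigroup ((M.mem_graph_iff hA u f).1 hu 1)
  · rintro ⟨x, hx⟩
    obtain ⟨u, -, hu⟩ := M.exists_orbit hx
    exact ⟨u, (M.mem_graph_iff hA u f).2 hu⟩

theorem fixed_of_mem_ker {u : (semigroupGenerator T).domain}
    (hu : u ∈ LinearMap.ker (semigroupGenerator T).toFun) (t : ℝ≥0) : T t u = (u : E) := by
  have h := (M.mem_graph_iff hA u 0).1 (by
    have := LinearPMap.mem_graph (semigroupGenerator T) u
    rwa [show semigroupGenerator T u = 0 from hu] at this) t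
  rwa [map_zero, sub_eq_zero] at h

/-- Sampling is an isomorphism from the kernel of the generator onto that of the difference
operator. -/
theorem nonempty_ker_equiv : Nonempty (LinearMap.ker (semigroupGenerator T).toFun ≃ₗ[𝕜]
    LinearMap.ker D.toLinearMap) := by
  have hmem : ∀ u : LinearMap.ker (semigroupGenerator T).toFun,
      M.sampling (u : (semigroupGenerator T).domain) ∈ LinearMap.ker D.toLinearMap := by
    intro u
    have hu := M.fixed_of_mem_ker hA u.2 1
    refine M.seq_ext _ _ (funext fun n => ?_)
    have h1 : V.prop n (n - 1) (M.seq (M.sampling (u : (semigroupGenerator T).domain)) (n - 1)) =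
        M.seq (M.sampling (u : (semigroupGenerator T).domain)) n := by
      rw [M.seq_sampling, M.seq_sampling]
      push_cast
      rw [V.prop_integral (M.locallyIntegrable _) (by simp) le_rfl (by simp)]
      have := M.integral_prop_semigroup 1 (u : (semigroupGenerator T).domain)
        (show (n : ℝ) - 1 ≤ n by simp) le_rfl
      rw [hu, NNReal.coe_one] at this
      exact this.symm
    change M.seq (D _) n = _
    rw [M.seq_difference, h1, sub_self, M.seq_zero]
    rfl
  let φ : LinearMap.ker (semigroupGenerator T).toFun →ₗ[𝕜] LinearMap.ker D.toLinearMap :=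
    (M.sampling.toLinearMap ∘ₗ (semigroupGenerator T).domain.subtype ∘ₗ
      (LinearMap.ker (semigroupGenerator T).toFun).subtype).codRestrict _ hmem
  refine ⟨LinearEquiv.ofBijective φ ⟨?_, fun x => ?_⟩⟩
  · rw [← LinearMap.ker_eq_bot, LinearMap.ker_eq_bot']
    intro u hu
    have hu' := M.fixed_of_mem_ker hA u.2
    have h1 := integrated_one_of_fixed M.integrated_add hA hu'
    rw [M.integrated_one_eq_zero (hu' 1) (congrArg Subtype.val hu)] at h1
    exact Subtype.ext (Subtype.ext h1.symm)
  · have hx : D (x : S) = -M.sampling 0 := by rw [map_zero, neg_zero]; exact x.2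
    obtain ⟨u, hu, hT⟩ := M.exists_orbit hx
    obtain ⟨y, hy, hy0⟩ := (LinearPMap.mem_graph_iff _).1 ((M.mem_graph_iff hA u 0).2 hT)
    refine ⟨⟨y, hy0⟩, Subtype.ext (M.seq_ext _ _ (funext fun n => ?_))⟩
    change M.seq (M.sampling (y : E)) n = _
    rw [hy, M.seq_sampling, V.integral_prop_congr hu]
    have hn : (n : ℝ) - 1 ≤ n := by simp
    have hd : ∀ n : ℤ, M.seq (x : S) n - V.prop n (n - 1) (M.seq (x : S) (n - 1)) =
        -∫ s in ((n : ℝ) - 1)..n, V.prop n s (M.eval 0 s) := fun n => by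
      rw [← M.seq_difference, hx, M.seq_neg, Pi.neg_apply, M.seq_sampling]
    have h0 : ∀ t a b : ℝ, ∫ s in a..b, V.prop t s (M.eval 0 s) = 0 := fun t a b => by
      rw [V.integral_prop_congr M.eval_zero]; simp
    rw [intervalIntegral.integral_congr (g := fun _ => M.seq (x : S) n)]
    · simp
    · intro s hs
      rw [Set.uIcc_of_le hn] at hs
      have := V.orbit_mild (M.locallyIntegrable 0) hd hs.2
      simp only
      rw [this, h0, add_zero, EvolutionFamily.orbit, h0]
      simp

/-- The comparison of generator and difference operator in a cell model. -/
theorem fredholm_comparison [CompleteSpace S] :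
    Nonempty (LinearMap.ker (semigroupGenerator T).toFun ≃ₗ[𝕜] LinearMap.ker D.toLinearMap) ∧
    Nonempty ((E ⧸ LinearMap.range (semigroupGenerator T).toFun) ≃ₗ[𝕜]
      (S ⧸ LinearMap.range D.toLinearMap)) ∧
    (IsClosed (LinearMap.range (semigroupGenerator T).toFun : Set E) ↔
      IsClosed (LinearMap.range D.toLinearMap : Set S)) ∧
    (IsFredholmPMap (semigroupGenerator T) ↔ D.IsFredholm) ∧
    (semigroupGenerator T).toFun.index = D.toLinearMap.index := by
  obtain ⟨e⟩ := M.nonempty_ker_equiv hA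
  obtain ⟨c, h1, h2, h3⟩ := fredholm_transfer (M.isClosed_generator hA) M.sampling M.spreading
    M.sampling_spreading (M.mem_range_generator_iff hA) e
  exact ⟨⟨e⟩, ⟨c⟩, h1, h2, h3⟩

end Cell

end CellModel

end Model

/-! ### Functions vanishing at infinity -/

theorem exists_norm_le_of_tendsto_cocompact {Y : Type*} [NormedAddCommGroup Y] {f : ℝ → Y}
    (hf : Tendsto f (cocompact ℝ) (𝓝 0)) {ε : ℝ} (hε : 0 < ε) :
    ∃ R : ℝ, ∀ t, R < |t| → ‖f t‖ ≤ ε := by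
  have h := hf.norm.eventually (eventually_le_nhds (show ‖(0 : Y)‖ < ε by simpa))
  rw [← Metric.cobounded_eq_cocompact,
    (Metric.hasBasis_cobounded_compl_closedBall 0).eventually_iff] at h
  obtain ⟨R, -, hR⟩ := h
  exact ⟨R, fun t ht => hR (by simpa using ht)⟩

theorem tendsto_integral_norm_window {Y : Type*} [NormedAddCommGroup Y] {f : ℝ → Y}
    (hf : Tendsto f (cocompact ℝ) (𝓝 0)) (h : ℝ≥0) :
    Tendsto (fun t : ℝ => ∫ s in (t - h)..t, ‖f s‖) (cocompact ℝ) (𝓝 0) := by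
  rw [Metric.tendsto_nhds]
  intro ε hε
  obtain ⟨R, hR⟩ := exists_norm_le_of_tendsto_cocompact hf (ε := ε / (h + 1)) (by positivity)
  rw [← Metric.cobounded_eq_cocompact,
    (Metric.hasBasis_cobounded_compl_closedBall 0).eventually_iff]
  refine ⟨R + h, trivial, fun t ht => ?_⟩
  have ht' : R + h < |t| := by simpa using ht
  rw [dist_zero_right]
  have h1 : ‖∫ s in (t - h)..t, ‖f s‖‖ ≤ ε / (h + 1) * |t - (t - h)| := by
    refine intervalIntegral.norm_integral_le_of_norm_le_const fun s hs => ?_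
    rw [Set.uIoc_of_le (by simp)] at hs
    rw [norm_norm]
    refine hR s ?_
    have h2 : |t| ≤ |s| + |t - s| := by simpa using abs_add_le s (t - s)
    have h3 : |t - s| ≤ h := abs_le.2 ⟨by linarith [hs.2, h.2], by linarith [hs.1]⟩
    linarith
  refine h1.trans_lt ?_
  rw [sub_sub_cancel, NNReal.abs_eq, div_mul_eq_mul_div, div_lt_iff₀ (by positivity)]
  nlinarith

theorem tendsto_floor_cocompact : Tendsto (fun t : ℝ => ⌊t⌋) (cocompact ℝ) (cocompact ℤ) := by
  rw [_root_.cocompact_eq_atBot_atTop, cocompact_eq_cofinite, Int.cofinite_eq]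
  exact tendsto_floor_atBot.sup_sup tendsto_floor_atTop

namespace ZeroAtInftyContinuousMap

variable {α Y : Type*} [TopologicalSpace α] [NormedAddCommGroup Y]

theorem norm_apply_le_norm (f : C₀(α, Y)) (a : α) : ‖f a‖ ≤ ‖f‖ :=
  f.toBCF.norm_coe_le_norm a

theorem norm_le_of_forall_le {f : C₀(α, Y)} {C : ℝ} (hC : 0 ≤ C) (h : ∀ a, ‖f a‖ ≤ C) : ‖f‖ ≤ C :=
  (BoundedContinuousFunction.norm_le (f := f.toBCF) hC).2 h

theorem integral_norm_le (f : C₀(ℝ, Y)) {a b : ℝ} (hab : a ≤ b) :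
    ∫ s in a..b, ‖f s‖ ≤ (b - a) * ‖f‖ := by
  refine (intervalIntegral.integral_mono_on hab (Continuous.intervalIntegrable (by fun_prop) _ _)
    intervalIntegrable_const fun s _ => f.norm_apply_le_norm s).trans (by simp)

end ZeroAtInftyContinuousMap

namespace EvolutionFamily

variable {𝕜 X : Type*} [RCLike 𝕜] [NormedAddCommGroup X] [NormedSpace 𝕜 X]

theorem eventually_norm_prop_sub_le (V : EvolutionFamily 𝕜 X) {f : ℝ → X} (hf : Continuous f)
    (h0 : Tendsto f (cocompact ℝ) (𝓝 0)) {ε : ℝ} (hε : 0 < ε) :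
    ∀ᶠ r : ℝ in 𝓝 0, 0 ≤ r → ∀ t, ‖V.prop t (t - r) (f (t - r)) - f t‖ ≤ ε := by
  obtain ⟨C, hC0, hC⟩ := V.exists_prop_bound 1
  obtain ⟨R, hR⟩ := exists_norm_le_of_tendsto_cocompact h0 (ε := ε / (C + 1)) (by positivity)
  have hK : ∀ᶠ r : ℝ in 𝓝 0, ∀ t ∈ Metric.closedBall (0 : ℝ) (R + 1),
      ‖V.prop t (t - r) (f (t - r)) - f t‖ < ε := by
    refine (isCompact_closedBall _ _).eventually_forall_of_forall_eventually fun t _ => ?_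
    have hc : Continuous fun z : ℝ × ℝ => ‖V.prop z.2 (z.2 - z.1) (f (z.2 - z.1)) - f z.2‖ :=
      ((V.continuous_prop_comp (by fun_prop) (by fun_prop) (by fun_prop)).sub (by fun_prop)).norm
    refine hc.continuousAt.eventually_lt continuousAt_const ?_
    simpa using hε
  filter_upwards [hK, eventually_le_nhds zero_lt_one] with r hr hr1 hr0 t
  by_cases ht : t ∈ Metric.closedBall (0 : ℝ) (R + 1)
  · exact (hr t ht).le
  · have ht' : R + 1 < |t| := by simpa using ht
    have h1 := hR t (by linarith)
    have h2 := hR (t - r) (by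
      have := abs_sub_abs_le_abs_sub t r
      rw [abs_of_nonneg hr0] at this
      linarith)
    calc _ ≤ C * ‖f (t - r)‖ + ‖f t‖ :=
          (norm_sub_le _ _).trans (by gcongr; exact V.norm_prop_le hC (by linarith) _)
      _ ≤ C * (ε / (C + 1)) + ε / (C + 1) := by gcongr
      _ = ε := by field_simp

/-- For a continuous function vanishing at infinity, the backward averages along the propagator
converge uniformly on the line. -/
theorem eventually_norm_average_sub_le [NormedSpace ℝ X] [CompleteSpace X]
    (V : EvolutionFamily 𝕜 X) {f : ℝ → X} (hf : Continuous f)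
    (h0 : Tendsto f (cocompact ℝ) (𝓝 0)) {ε : ℝ} (hε : 0 < ε) :
    ∀ᶠ h : ℝ≥0 in 𝓝[>] 0, ∀ t : ℝ,
      ‖(h : ℝ)⁻¹ • (∫ s in (t - h)..t, V.prop t s (f s)) - f t‖ ≤ ε := by
  obtain ⟨δ, hδ, H⟩ := Metric.eventually_nhds_iff.1 (V.eventually_norm_prop_sub_le hf h0 hε)
  have h1 : ∀ᶠ h : ℝ≥0 in 𝓝[>] 0, (h : ℝ) < δ :=
    mem_nhdsWithin_of_mem_nhds (NNReal.continuous_coe.continuousAt.eventually_lt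
      continuousAt_const (by simpa using hδ))
  filter_upwards [h1, self_mem_nhdsWithin] with h hh hpos t
  have hpos' : (0 : ℝ) < h := hpos
  have e : (h : ℝ)⁻¹ • (∫ s in (t - h)..t, V.prop t s (f s)) - f t =
      (h : ℝ)⁻¹ • ∫ s in (t - h)..t, (V.prop t s (f s) - f t) := by
    rw [intervalIntegral.integral_sub (V.intervalIntegrable_prop hf.locallyIntegrable _ _ _)
      intervalIntegrable_const, smul_sub]
    simp [smul_smul, hpos'.ne']
  rw [e, norm_smul, norm_inv, Real.norm_of_nonneg hpos'.le, inv_mul_le_iff₀ hpos', mul_comm]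
  refine (intervalIntegral.norm_integral_le_of_norm_le_const (C := ε) fun s hs => ?_).trans
    (by simp)
  rw [Set.uIoc_of_le (by simp)] at hs
  have := H (y := t - s) (by rw [dist_zero_right, Real.norm_of_nonneg (by linarith [hs.2])]
                             linarith [hs.1]) (by linarith [hs.2]) t
  rwa [sub_sub_cancel] at this

/-! ### The model on continuous functions vanishing at infinity -/

theorem exists_C0_of_norm_le {Y Z : Type*} [TopologicalSpace Y] [NormedAddCommGroup Z]
    {w : Y → Z} {g : Y → ℝ} (hw : Continuous w) (hwg : ∀ t, ‖w t‖ ≤ g t)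
    (hg : Tendsto g (cocompact Y) (𝓝 0)) {C : ℝ} (hC : 0 ≤ C) (hgC : ∀ t, g t ≤ C) :
    ∃ v : C₀(Y, Z), ⇑v = w ∧ ‖v‖ ≤ C :=
  ⟨⟨⟨w, hw⟩, squeeze_zero_norm hwg hg⟩, rfl,
    ZeroAtInftyContinuousMap.norm_le_of_forall_le hC fun t => (hwg t).trans (hgC t)⟩

/-- The spaces `C₀(ℝ; X)` and `c₀(ℤ; X)` form a cell model. -/
noncomputable def cellModelC0 (V : EvolutionFamily 𝕜 X) :
    CellModel V V.semigroupC0 V.differenceC0 where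
  eval u := u
  seq x := x
  locallyIntegrable u := (map_continuous u).locallyIntegrable
  eval_ext u v h := DFunLike.coe_injective
    (((map_continuous u).ae_eq_iff_eq volume (map_continuous v)).1 h)
  eval_add u v := Eventually.of_forall fun _ => rfl
  eval_smul c u := Eventually.of_forall fun _ => rfl
  seq_ext x y h := DFunLike.coe_injective h
  seq_add x y := rfl
  seq_smul c x := rfl
  eval_semigroup t u := Eventually.of_forall fun τ => by
    simp only [V.semigroupC0_apply]
    rw [V.prop_of_le (by simp)]
  seq_difference x n := by rw [V.differenceC0_apply, V.prop_of_le (by simp)]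
  exists_seq y u C hC hy := by
    refine exists_C0_of_norm_le continuous_of_discreteTopology hy ?_ (by positivity) fun n => ?_
    · have := ((tendsto_integral_norm_window (zero_at_infty u) 1).comp
        Int.isClosedEmbedding_coe_real.tendsto_cocompact).const_mul C
      simpa using this
    · gcongr
      simpa using u.integral_norm_le (a := (n : ℝ) - 1) (b := n) (by simp)
  exists_eval w x f C hC hw hwb := by
    have h : ∃ v : C₀(ℝ, X), ⇑v = w ∧ ‖v‖ ≤ C * (‖x‖ + ‖f‖) := by
      refine exists_C0_of_norm_le hw hwb ?_ (by positivity) fun t => ?_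
      · have h1 := ((zero_at_infty x).comp tendsto_floor_cocompact).norm
        have h2 := (tendsto_integral_norm_window (zero_at_infty f) 1).comp
          (Int.isClosedEmbedding_coe_real.tendsto_cocompact.comp
            ((Homeomorph.addRight (1 : ℤ)).isClosedEmbedding.tendsto_cocompact.comp
              tendsto_floor_cocompact))
        simpa [Function.comp_def] using (h1.add h2).const_mul C
      · gcongr
        · exact x.norm_apply_le_norm _
        · simpa using f.integral_norm_le (a := (⌊t⌋ : ℝ)) (b := ⌊t⌋ + 1) (by simp)
    obtain ⟨v, hv, hn⟩ := h
    exact ⟨v, by rw [hv], hn⟩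
  exists_window h w f C hC hw hwb := by
    have h : ∃ v : C₀(ℝ, X), ⇑v = w ∧ ‖v‖ ≤ C * h * ‖f‖ := by
      refine exists_C0_of_norm_le hw hwb ?_ (by positivity) fun t => ?_
      · simpa using (tendsto_integral_norm_window (zero_at_infty f) h).const_mul C
      · rw [mul_assoc]
        gcongr
        simpa using f.integral_norm_le (a := t - h) (b := t) (by simp)
    obtain ⟨v, hv, hn⟩ := h
    exact ⟨v, by rw [hv], hn⟩

theorem tendsto_integrated_C0 [NormedSpace ℝ X] [IsScalarTower ℝ 𝕜 X] [CompleteSpace X]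
    (V : EvolutionFamily 𝕜 X) (u : C₀(ℝ, X)) :
    Tendsto (fun h : ℝ≥0 => ((h : ℝ) : 𝕜)⁻¹ • V.cellModelC0.integrated h u) (𝓝[>] 0) (𝓝 u) := by
  rw [Metric.tendsto_nhds]
  intro ε hε
  filter_upwards [V.eventually_norm_average_sub_le (map_continuous u) (zero_at_infty u)
    (half_pos hε)] with h hh
  rw [dist_eq_norm]
  refine (ZeroAtInftyContinuousMap.norm_le_of_forall_le (half_pos hε).le fun t => ?_).trans_lt
    (half_lt_self hε)
  have he : ⇑(V.cellModelC0.integrated h u) =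
      fun t : ℝ => ∫ s in (t - h)..t, V.prop t s (u s) :=
    ((map_continuous _).ae_eq_iff_eq volume (V.continuous_integral_prop_comp
      (map_continuous u).locallyIntegrable continuous_id (by fun_prop) continuous_id)).1
      (V.cellModelC0.eval_integrated h u)
  have := hh t
  rw [RCLike.real_smul_eq_coe_smul (K := 𝕜), RCLike.ofReal_inv] at this
  simpa [he] using this

end EvolutionFamily

/-! ### Estimates in `L_p` on unit cells and moving windows -/

section LpEstimates

variable {Y Z : Type*} [NormedAddCommGroup Y] [NormedAddCommGroup Z]

/-- Jensen's inequality for the average of `‖f‖` over an interval. -/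
theorem rpow_integral_norm_le {p : ℝ≥0∞} (hp1 : 1 ≤ p) (hp : p ≠ ∞) {f : ℝ → Y}
    (hf : MemLp f p volume) {a b : ℝ} (hab : a < b) :
    (∫ s in a..b, ‖f s‖) ^ p.toReal ≤
      (b - a) ^ p.toReal * ((b - a)⁻¹ * ∫ s in a..b, ‖f s‖ ^ p.toReal) := by
  have hq : 1 ≤ p.toReal := by
    rw [← ENNReal.toReal_one]
    exact ENNReal.toReal_mono hp hp1
  have hba : 0 < b - a := sub_pos.2 hab
  have h1 := (convexOn_rpow hq).map_set_average_le (μ := volume) (t := Set.Ioc a b)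
    (f := fun s => ‖f s‖) (Real.continuous_rpow_const (by positivity)).continuousOn isClosed_Ici
    (by simpa using hab) (by simp) (Eventually.of_forall fun s => norm_nonneg _)
    (((hf.locallyIntegrable hp1).intervalIntegrable_real (a := a) (b := b)).1.norm)
    ((hf.integrable_norm_rpow (by positivity) hp).integrableOn)
  simp only [setAverage_eq, smul_eq_mul, measureReal_def, Real.volume_Ioc,
    ENNReal.toReal_ofReal hba.le] at h1
  rw [intervalIntegral.integral_of_le hab.le, intervalIntegral.integral_of_le hab.le]
  have h0 : 0 ≤ ∫ s in Set.Ioc a b, ‖f s‖ := integral_nonneg fun _ => norm_nonneg _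
  calc _ = (b - a) ^ p.toReal * ((b - a)⁻¹ * ∫ s in Set.Ioc a b, ‖f s‖) ^ p.toReal := by
        rw [← Real.mul_rpow hba.le (by positivity), mul_inv_cancel_left₀ hba.ne']
    _ ≤ _ := by gcongr

/-- A sequence dominated by the integrals of `‖f‖` over unit cells is in `ℓ_p` if `f` is in
`L_p`. -/
theorem exists_lp_of_norm_le_integral {p : ℝ≥0∞} [hp1 : Fact (1 ≤ p)] (hp : p ≠ ∞)
    (f : Lp Y p (volume : Measure ℝ)) {y : ℤ → Z} {C : ℝ} (hC : 0 ≤ C) (a : ℝ)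
    (hy : ∀ n : ℤ, ‖y n‖ ≤ C * ∫ s in (a + n)..(a + n + 1), ‖f s‖) :
    ∃ x : lp (fun _ : ℤ => Z) p, ⇑x = y ∧ ‖x‖ ≤ C * ‖f‖ := by
  have hq : 0 < p.toReal := ENNReal.toReal_pos (zero_lt_one.trans_le hp1.out).ne' hp
  have hs := ((((Lp.memLp f).integrable_norm_rpow
    (zero_lt_one.trans_le hp1.out).ne' hp)).hasSum_intervalIntegral a).mul_left (C ^ p.toReal)
  have hfn : ∫ s, ‖f s‖ ^ p.toReal = ‖f‖ ^ p.toReal := by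
    rw [Lp.norm_def, (Lp.memLp f).eLpNorm_eq_integral_rpow_norm
      (zero_lt_one.trans_le hp1.out).ne' hp, ENNReal.toReal_ofReal (by positivity),
      ← Real.rpow_mul (integral_nonneg fun _ => by positivity), inv_mul_cancel₀ hq.ne',
      Real.rpow_one]
  have hle : ∀ n : ℤ, ‖y n‖ ^ p.toReal ≤
      C ^ p.toReal * ∫ s in (a + n)..(a + n + 1), ‖f s‖ ^ p.toReal := by
    intro n
    have h0 : 0 ≤ ∫ s in (a + n)..(a + n + 1), ‖f s‖ :=
      intervalIntegral.integral_nonneg (by simp) fun _ _ => norm_nonneg _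
    have h1 := rpow_integral_norm_le hp1.out hp (Lp.memLp f) (show a + n < a + n + 1 by simp)
    rw [add_sub_cancel_left, Real.one_rpow, inv_one, one_mul, one_mul] at h1
    calc _ ≤ (C * ∫ s in (a + n)..(a + n + 1), ‖f s‖) ^ p.toReal := by gcongr; exact hy n
      _ = C ^ p.toReal * (∫ s in (a + n)..(a + n + 1), ‖f s‖) ^ p.toReal := Real.mul_rpow hC h0
      _ ≤ _ := by gcongr
  have hsum : Summable fun n : ℤ => ‖y n‖ ^ p.toReal :=
    Summable.of_nonneg_of_le (fun n => by positivity) hle hs.summable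
  refine ⟨⟨y, memℓp_gen hsum⟩, rfl, lp.norm_le_of_tsum_le hq (by positivity) ?_⟩
  rw [Real.mul_rpow hC (norm_nonneg _), ← hfn]
  exact hasSum_le hle hsum.hasSum hs

theorem map_floor_volume : Measure.map (fun t : ℝ => ⌊t⌋) volume = Measure.count := by
  refine Measure.ext_of_singleton fun n => ?_
  rw [Measure.map_apply Int.measurable_floor (measurableSet_singleton n), Measure.count_singleton]
  have : (fun t : ℝ => ⌊t⌋) ⁻¹' {n} = Set.Ico (n : ℝ) (n + 1) := by
    ext t; simp
  rw [this, Real.volume_Ico]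
  simp

/-- The step function with the values of an `ℓ_p` sequence has the same norm in `L_p`. -/
theorem eLpNorm_comp_floor {p : ℝ≥0∞} [hp1 : Fact (1 ≤ p)] (hp : p ≠ ∞)
    (z : lp (fun _ : ℤ => Y) p) :
    eLpNorm (fun t : ℝ => z ⌊t⌋) p volume = ENNReal.ofReal ‖z‖ := by
  have hp0 : p ≠ 0 := (zero_lt_one.trans_le hp1.out).ne'
  have hq : 0 < p.toReal := ENNReal.toReal_pos hp0 hp
  have h1 := eLpNorm_map_measure (μ := (volume : Measure ℝ)) (p := p) (f := fun t : ℝ => ⌊t⌋)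
    (g := z) StronglyMeasurable.of_discrete.aestronglyMeasurable Int.measurable_floor.aemeasurable
  rw [map_floor_volume] at h1
  change eLpNorm (z ∘ fun t : ℝ => ⌊t⌋) p volume = _
  rw [← h1, eLpNorm_eq_lintegral_rpow_enorm_toReal hp0 hp, lintegral_count]
  have h2 : ∀ n : ℤ, ‖z n‖ₑ ^ p.toReal = ENNReal.ofReal (‖z n‖ ^ p.toReal) := fun n => by
    rw [← ofReal_norm, ENNReal.ofReal_rpow_of_nonneg (norm_nonneg _) hq.le]
  simp_rw [h2]
  rw [← ENNReal.ofReal_tsum_of_nonneg (fun n => by positivity) (lp.hasSum_norm hq z).summable,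
    ← lp.norm_rpow_eq_tsum hq, ENNReal.ofReal_rpow_of_nonneg (by positivity) (by positivity),
    one_div, Real.rpow_rpow_inv (norm_nonneg _) hq.ne']

theorem lintegral_window {Φ : ℝ → ℝ≥0∞} (hΦ : Measurable Φ) (h : ℝ≥0) :
    ∫⁻ t : ℝ, ∫⁻ s in Set.Ioc (t - h) t, Φ s = h * ∫⁻ s, Φ s := by
  have e : ∀ t s : ℝ, (Set.Ioc (t - h) t).indicator Φ s =
      (Set.Ico s (s + h)).indicator (fun _ => Φ s) t := by
    intro t s
    have : s ∈ Set.Ioc (t - h) t ↔ t ∈ Set.Ico s (s + h) := by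
      simp only [Set.mem_Ioc, Set.mem_Ico]
      constructor <;> rintro ⟨h1, h2⟩ <;> constructor <;> linarith
    by_cases hs : s ∈ Set.Ioc (t - h) t
    · rw [Set.indicator_of_mem hs, Set.indicator_of_mem (this.1 hs)]
    · rw [Set.indicator_of_notMem hs, Set.indicator_of_notMem (mt this.2 hs)]
  simp_rw [← lintegral_indicator measurableSet_Ioc]
  rw [lintegral_lintegral_swap]
  · simp_rw [e, lintegral_indicator measurableSet_Ico]
    simp only [lintegral_const, Measure.restrict_apply MeasurableSet.univ, Set.univ_inter,
      Real.volume_Ico, add_sub_cancel_left, ENNReal.ofReal_coe_nnreal]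
    rw [lintegral_mul_const _ hΦ, mul_comm]
  · have hm : MeasurableSet ({q : ℝ × ℝ | q.1 - h < q.2} ∩ {q | q.2 ≤ q.1}) :=
      (measurableSet_lt (by fun_prop) (by fun_prop)).inter
        (measurableSet_le (by fun_prop) (by fun_prop))
    exact ((hΦ.comp measurable_snd).indicator hm).aemeasurable

/-- Integrating over a moving window of length `h` has norm at most `h` on `L_p`. -/
theorem eLpNorm_le_of_norm_le_window {p : ℝ≥0∞} [hp1 : Fact (1 ≤ p)] (hp : p ≠ ∞) {h : ℝ≥0}
    (f : Lp Y p (volume : Measure ℝ)) {w : ℝ → Z} {C : ℝ} (hC : 0 ≤ C)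
    (hw : ∀ t : ℝ, ‖w t‖ ≤ C * ∫ s in (t - h)..t, ‖f s‖) :
    eLpNorm w p volume ≤ ENNReal.ofReal (C * h * ‖f‖) := by
  have hp0 : p ≠ 0 := (zero_lt_one.trans_le hp1.out).ne'
  have hq : 0 < p.toReal := ENNReal.toReal_pos hp0 hp
  rcases eq_or_ne h 0 with rfl | hh
  · have : w = 0 := funext fun t => norm_le_zero_iff.1 (by simpa using hw t)
    simp [this]
  have hh' : (0 : ℝ) < h := by positivity
  have hF := (Lp.memLp f).integrable_norm_rpow hp0 hp
  have hpt : ∀ t, ‖w t‖ₑ ^ p.toReal ≤ ENNReal.ofReal ((C * h) ^ p.toReal * (h : ℝ)⁻¹) *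
      ∫⁻ s in Set.Ioc (t - h) t, ‖f s‖ₑ ^ p.toReal := by
    intro t
    have h0 : 0 ≤ ∫ s in (t - h)..t, ‖f s‖ :=
      intervalIntegral.integral_nonneg (by simp) fun _ _ => norm_nonneg _
    have h1 := rpow_integral_norm_le hp1.out hp (Lp.memLp f) (show t - h < t by simpa using hh')
    rw [sub_sub_cancel] at h1
    have h2 : ‖w t‖ ^ p.toReal ≤ (C * h) ^ p.toReal * (h : ℝ)⁻¹ *
        ∫ s in (t - h)..t, ‖f s‖ ^ p.toReal := by
      calc _ ≤ (C * ∫ s in (t - h)..t, ‖f s‖) ^ p.toReal := by gcongr; exact hw t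
        _ = C ^ p.toReal * (∫ s in (t - h)..t, ‖f s‖) ^ p.toReal := Real.mul_rpow hC h0
        _ ≤ C ^ p.toReal * ((h : ℝ) ^ p.toReal *
              ((h : ℝ)⁻¹ * ∫ s in (t - h)..t, ‖f s‖ ^ p.toReal)) := by gcongr
        _ = _ := by rw [Real.mul_rpow hC hh'.le]; ring
    rw [← ofReal_norm, ENNReal.ofReal_rpow_of_nonneg (norm_nonneg _) hq.le]
    refine (ENNReal.ofReal_le_ofReal h2).trans (le_of_eq ?_)
    rw [ENNReal.ofReal_mul (by positivity), intervalIntegral.integral_of_le (by simp),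
      ofReal_integral_eq_lintegral_ofReal hF.integrableOn
        (Eventually.of_forall fun s => by positivity)]
    congr 1
    refine lintegral_congr fun s => ?_
    rw [← ofReal_norm, ENNReal.ofReal_rpow_of_nonneg (norm_nonneg _) hq.le]
  have hm : Measurable fun s => ‖f s‖ₑ ^ p.toReal :=
    (Lp.stronglyMeasurable f).enorm.pow_const _
  rw [eLpNorm_eq_lintegral_rpow_enorm_toReal hp0 hp]
  calc _ ≤ (∫⁻ t : ℝ, ENNReal.ofReal ((C * h) ^ p.toReal * (h : ℝ)⁻¹) *
        ∫⁻ s in Set.Ioc (t - h) t, ‖f s‖ₑ ^ p.toReal) ^ (1 / p.toReal) := by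
        gcongr with t; exact hpt t
    _ = (ENNReal.ofReal ((C * h) ^ p.toReal) * ∫⁻ s, ‖f s‖ₑ ^ p.toReal) ^ (1 / p.toReal) := by
        rw [lintegral_const_mul' _ _ ENNReal.ofReal_ne_top, lintegral_window hm, ← mul_assoc,
          ← ENNReal.ofReal_coe_nnreal (p := h), ← ENNReal.ofReal_mul (by positivity),
          inv_mul_cancel_right₀ hh'.ne']
    _ = ENNReal.ofReal (C * h) * eLpNorm f p volume := by
        rw [ENNReal.mul_rpow_of_nonneg _ _ (by positivity),
          ENNReal.ofReal_rpow_of_nonneg (by positivity) (by positivity), one_div,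
          Real.rpow_rpow_inv (by positivity) hq.ne', eLpNorm_eq_lintegral_rpow_enorm_toReal hp0 hp,
          one_div]
    _ = _ := by rw [ENNReal.ofReal_mul (p := C * h) (by positivity), Lp.norm_def,
          ENNReal.ofReal_toReal (Lp.eLpNorm_ne_top f)]

theorem exists_Lp_of_eLpNorm_le {p : ℝ≥0∞} {w : ℝ → Y} (hw : AEStronglyMeasurable w volume)
    {C : ℝ} (hC : 0 ≤ C) (h : eLpNorm w p volume ≤ ENNReal.ofReal C) :
    ∃ v : Lp Y p (volume : Measure ℝ), v =ᵐ[volume] w ∧ ‖v‖ ≤ C := by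
  have hm : MemLp w p volume := ⟨hw, h.trans_lt ENNReal.ofReal_lt_top⟩
  refine ⟨hm.toLp w, hm.coeFn_toLp, ?_⟩
  rw [Lp.norm_toLp]
  exact ENNReal.toReal_le_of_le_ofReal hC h

end LpEstimates

namespace EvolutionFamily

variable {𝕜 X : Type*} [RCLike 𝕜] [NormedAddCommGroup X] [NormedSpace 𝕜 X]

/-! ### The model on `L_p` -/

/-- The spaces `L_p(ℝ; X)` and `ℓ_p(ℤ; X)`, `1 ≤ p < ∞`, form a cell model. -/
noncomputable def cellModelLp (V : EvolutionFamily 𝕜 X) (p : ℝ≥0∞) [hp1 : Fact (1 ≤ p)]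
    (hp : p ≠ ∞) : CellModel V (V.semigroupLp p) (V.differenceLp p) where
  eval u := u
  seq x := x
  locallyIntegrable u := (Lp.memLp u).locallyIntegrable hp1.out
  eval_ext u v h := Lp.ext h
  eval_add u v := Lp.coeFn_add u v
  eval_smul c u := Lp.coeFn_smul c u
  seq_ext x y h := lp.ext h
  seq_add x y := lp.coeFn_add x y
  seq_smul c x := lp.coeFn_smul c x
  eval_semigroup t u := by
    filter_upwards [V.semigroupLp_apply p t u] with τ h
    rw [h, V.prop_of_le (by simp)]
  seq_difference x n := by rw [V.differenceLp_apply, V.prop_of_le (by simp)]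
  exists_seq y u C hC hy := by
    refine exists_lp_of_norm_le_integral hp u hC (-1) fun n => (hy n).trans (le_of_eq ?_)
    congr 2 <;> ring
  exists_eval w x f C hC hw hwb := by
    have hq : 0 < p.toReal := ENNReal.toReal_pos (zero_lt_one.trans_le hp1.out).ne' hp
    obtain ⟨z, hz, hzn⟩ := exists_lp_of_norm_le_integral (Z := ℝ) hp f zero_le_one 0
      (y := fun n : ℤ => ∫ s in (n : ℝ)..(n + 1), ‖f s‖) fun n => by
        rw [one_mul, zero_add, Real.norm_of_nonneg
          (intervalIntegral.integral_nonneg (by simp) fun _ _ => norm_nonneg _)]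
    have hxs : Summable fun n : ℤ => ‖‖x n‖‖ ^ p.toReal := by
      simpa using (lp.hasSum_norm hq x).summable
    let x' : lp (fun _ : ℤ => ℝ) p := ⟨fun n => ‖x n‖, memℓp_gen hxs⟩
    have hx' : ‖x'‖ ≤ ‖x‖ := by
      refine lp.norm_le_of_tsum_le hq (norm_nonneg _) ?_
      rw [lp.norm_rpow_eq_tsum hq x]
      exact le_of_eq (tsum_congr fun n => by simp [x'])
    refine exists_Lp_of_eLpNorm_le hw.aestronglyMeasurable (by positivity) ?_
    calc eLpNorm w p volume ≤ ENNReal.ofReal C * eLpNorm (fun t : ℝ => (x' + z) ⌊t⌋) p volume := by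
          refine eLpNorm_le_mul_eLpNorm_of_ae_le_mul (Eventually.of_forall fun t => ?_) p
          refine (hwb t).trans ?_
          gcongr
          rw [lp.coeFn_add, Pi.add_apply, hz]
          exact Real.le_norm_self _
      _ ≤ ENNReal.ofReal (C * (‖x‖ + ‖f‖)) := by
          rw [eLpNorm_comp_floor hp, ← ENNReal.ofReal_mul hC]
          gcongr
          exact (norm_add_le _ _).trans (add_le_add hx' (by simpa using hzn))
  exists_window h w f C hC hw hwb :=
    exists_Lp_of_eLpNorm_le hw.aestronglyMeasurable (by positivity)
      (eLpNorm_le_of_norm_le_window hp f hC hwb)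

variable [NormedSpace ℝ X] [IsScalarTower ℝ 𝕜 X] [CompleteSpace X]

/-- On continuous functions with compact support the averages converge uniformly, and they stay
supported in a fixed ball. -/
theorem tendsto_integrated_toLp (V : EvolutionFamily 𝕜 X) (p : ℝ≥0∞) [hp1 : Fact (1 ≤ p)]
    (hp : p ≠ ∞) {g : ℝ → X} (hg : Continuous g) (hgc : HasCompactSupport g)
    (hgp : MemLp g p volume) :
    Tendsto (fun h : ℝ≥0 => ((h : ℝ) : 𝕜)⁻¹ • (V.cellModelLp p hp).integrated h (hgp.toLp g))
      (𝓝[>] 0) (𝓝 (hgp.toLp g)) := by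
  obtain ⟨R, hR⟩ := hgc.isCompact.isBounded.subset_closedBall 0
  have hg0 : ∀ t, R < |t| → g t = 0 := fun t ht => image_eq_zero_of_notMem_tsupport fun hm => by
    have := hR hm
    simp only [Metric.mem_closedBall, dist_zero_right, Real.norm_eq_abs] at this
    linarith
  set B : ℝ≥0∞ := volume (Metric.closedBall (0 : ℝ) (R + 1)) ^ p.toReal⁻¹
  have hB : B ≠ ∞ := ENNReal.rpow_ne_top_of_nonneg (by positivity) measure_closedBall_lt_top.ne
  rw [Metric.tendsto_nhds]
  intro ε hε
  set η : ℝ := ε / (2 * (B.toReal + 1))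
  have hη : 0 < η := by positivity
  have hle : ∀ᶠ h : ℝ≥0 in 𝓝[>] 0, h ≤ 1 :=
    mem_nhdsWithin_of_mem_nhds (Iic_mem_nhds zero_lt_one)
  filter_upwards [V.eventually_norm_average_sub_le hg hgc.is_zero_at_infty hη, hle] with h hh h1
  have h1' : (h : ℝ) ≤ 1 := by exact_mod_cast h1
  have hae : ⇑(((h : ℝ) : 𝕜)⁻¹ • (V.cellModelLp p hp).integrated h (hgp.toLp g) - hgp.toLp g)
      =ᵐ[volume] (Metric.closedBall (0 : ℝ) (R + 1)).indicator
        fun t => (h : ℝ)⁻¹ • (∫ s in (t - h)..t, V.prop t s (g s)) - g t := by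
    filter_upwards [Lp.coeFn_sub (((h : ℝ) : 𝕜)⁻¹ • (V.cellModelLp p hp).integrated h (hgp.toLp g))
      (hgp.toLp g),
      Lp.coeFn_smul (((h : ℝ) : 𝕜)⁻¹) ((V.cellModelLp p hp).integrated h (hgp.toLp g)),
      hgp.coeFn_toLp, (V.cellModelLp p hp).eval_integrated h (hgp.toLp g)] with t e1 e2 e3 e4
    have e4' : (V.cellModelLp p hp).integrated h (hgp.toLp g) t =
        ∫ s in (t - h)..t, V.prop t s (g s) :=
      e4.trans (V.integral_prop_congr hgp.coeFn_toLp _ _ _)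
    have e5 : (((h : ℝ) : 𝕜)⁻¹ • (V.cellModelLp p hp).integrated h (hgp.toLp g) - hgp.toLp g :
        Lp X p (volume : Measure ℝ)) t = (h : ℝ)⁻¹ • (∫ s in (t - h)..t, V.prop t s (g s)) - g t := by
      rw [e1, Pi.sub_apply, e2, Pi.smul_apply, e3, e4', RCLike.real_smul_eq_coe_smul (K := 𝕜),
        RCLike.ofReal_inv]
    rw [e5]
    by_cases ht : t ∈ Metric.closedBall (0 : ℝ) (R + 1)
    · rw [Set.indicator_of_mem ht]
    · have ht' : R + 1 < |t| := by simpa using ht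
      rw [Set.indicator_of_notMem ht, hg0 t (by linarith),
        intervalIntegral.integral_congr (g := fun _ => 0)]
      · simp
      · intro s hs
        rw [Set.uIcc_of_le (by simp)] at hs
        have h3 : |t| - |s| ≤ |t - s| := abs_sub_abs_le_abs_sub t s
        have h4 : |t - s| ≤ 1 := abs_le.2 ⟨by linarith [hs.2], by linarith [hs.1]⟩
        simp only
        rw [hg0 s (by linarith), map_zero]
  rw [dist_eq_norm, Lp.norm_def, eLpNorm_congr_ae hae,
    eLpNorm_indicator_eq_eLpNorm_restrict Metric.isClosed_closedBall.measurableSet]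
  have hfin := eLpNorm_le_of_ae_bound (p := p)
    (μ := volume.restrict (Metric.closedBall (0 : ℝ) (R + 1))) (Eventually.of_forall hh)
  rw [Measure.restrict_apply_univ] at hfin
  have h5 := ENNReal.toReal_mono (ENNReal.mul_ne_top hB ENNReal.ofReal_ne_top) hfin
  rw [ENNReal.toReal_mul, ENNReal.toReal_ofReal hη.le] at h5
  refine h5.trans_lt ?_
  calc B.toReal * η ≤ (B.toReal + 1) * η := by gcongr; linarith
    _ = ε / 2 := by simp only [η]; field_simp
    _ < ε := half_lt_self hε

theorem tendsto_integrated_Lp (V : EvolutionFamily 𝕜 X) (p : ℝ≥0∞) [hp1 : Fact (1 ≤ p)]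
    (hp : p ≠ ∞) (u : Lp X p (volume : Measure ℝ)) :
    Tendsto (fun h : ℝ≥0 => ((h : ℝ) : 𝕜)⁻¹ • (V.cellModelLp p hp).integrated h u)
      (𝓝[>] 0) (𝓝 u) := by
  refine (V.cellModelLp p hp).tendsto_integrated_of_dense (Metric.dense_iff.2 fun v ε hε => ?_) u
  obtain ⟨g, hgc, hgn, hg, hgp⟩ := (Lp.memLp v).exists_hasCompactSupport_eLpNorm_sub_le hp
    (ε := ENNReal.ofReal (ε / 2)) (by simpa using hε)
  refine ⟨hgp.toLp g, ?_, V.tendsto_integrated_toLp p hp hg hgc hgp⟩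
  rw [Metric.mem_ball, dist_comm, dist_eq_norm, Lp.norm_def]
  have hae : ⇑(v - hgp.toLp g) =ᵐ[volume] ⇑v - g := by
    filter_upwards [Lp.coeFn_sub v (hgp.toLp g), hgp.coeFn_toLp] with t h1 h2
    rw [h1, Pi.sub_apply, Pi.sub_apply, h2]
  rw [eLpNorm_congr_ae hae]
  exact (ENNReal.toReal_le_of_le_ofReal (by positivity) hgn).trans_lt (half_lt_self hε)

end EvolutionFamily

/-! ### The Fredholm comparison -/

theorem mainTheorem4 {𝕜 : Type*} {X : Type*} [RCLike 𝕜] [NormedAddCommGroup X]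
    [NormedSpace 𝕜 X] [CompleteSpace X] (V : EvolutionFamily 𝕜 X) :
    (∀ (p : ℝ≥0∞) [Fact (1 ≤ p)], p ≠ ∞ →
      (IsClosed (LinearMap.range (V.generatorLp p).toFun : Set (Lp X p (volume : Measure ℝ))) ↔
        IsClosed (LinearMap.range (V.differenceLp p).toLinearMap :
          Set (lp (fun _ : ℤ => X) p))) ∧
      Module.rank 𝕜 (LinearMap.ker (V.generatorLp p).toFun) =
        Module.rank 𝕜 (LinearMap.ker (V.differenceLp p).toLinearMap) ∧
      Module.rank 𝕜 (Lp X p (volume : Measure ℝ) ⧸ LinearMap.range (V.generatorLp p).toFun) =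
        Module.rank 𝕜 (lp (fun _ : ℤ => X) p ⧸
          LinearMap.range (V.differenceLp p).toLinearMap) ∧
      (IsFredholmPMap (V.generatorLp p) ↔ (V.differenceLp p).IsFredholm) ∧
      (IsFredholmPMap (V.generatorLp p) →
        (V.generatorLp p).toFun.index = (V.differenceLp p).toLinearMap.index)) ∧
    (IsClosed (LinearMap.range V.generatorC0.toFun : Set C₀(ℝ, X)) ↔
      IsClosed (LinearMap.range V.differenceC0.toLinearMap : Set C₀(ℤ, X))) ∧
    Module.rank 𝕜 (LinearMap.ker V.generatorC0.toFun) =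
      Module.rank 𝕜 (LinearMap.ker V.differenceC0.toLinearMap) ∧
    Module.rank 𝕜 (C₀(ℝ, X) ⧸ LinearMap.range V.generatorC0.toFun) =
      Module.rank 𝕜 (C₀(ℤ, X) ⧸ LinearMap.range V.differenceC0.toLinearMap) ∧
    (IsFredholmPMap V.generatorC0 ↔ V.differenceC0.IsFredholm) ∧
    (IsFredholmPMap V.generatorC0 →
      V.generatorC0.toFun.index = V.differenceC0.toLinearMap.index) := by
  -- Bochner integrals need a real scalar action, compatible with the one of `𝕜`
  let _ : NormedSpace ℝ X := NormedSpace.restrictScalars ℝ 𝕜 X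
  have : IsScalarTower ℝ 𝕜 X := .of_algebraMap_smul fun _ _ => rfl
  constructor
  · intro p _ hp
    obtain ⟨⟨e⟩, ⟨c⟩, h1, h2, h3⟩ :=
      (V.cellModelLp p hp).fredholm_comparison (V.tendsto_integrated_Lp p hp)
    exact ⟨h1, e.rank_eq, c.rank_eq, h2, fun _ => h3⟩
  · obtain ⟨⟨e⟩, ⟨c⟩, h1, h2, h3⟩ := V.cellModelC0.fredholm_comparison V.tendsto_integrated_C0
    exact ⟨h1, e.rank_eq, c.rank_eq, h2, fun _ => h3⟩
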